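/- For a finite simple graph $G$ and an activity $\lambda>0$ let $Z_\lambda(G)=\sum_{M}\lambda^{|M|}$, where $M$ ranges over all matchings of $G$, i.e. over all sets of pairwise disjoint edges of $G$ (including the empty set). For $0<\varepsilon<1$, a number $\hat Z$ is an $\varepsilon$-approximation of $Z$ if $(1-\varepsilon)Z\le\hat Z\le(1+\varepsilon)Z$. Algorithms are programs of a deterministic random access machine with exact real arithmetic (real RAM): at unit cost each, it adds and (truncatedly) subtracts natural numbers, adds, subtracts, multiplies and divides real numbers, copies between registers and memory by indirect addressing, and compares two natural or two real registers; there is no rounding operation, and the constants of a program are natural and rational numbers. There are a deterministic algorithm and a universal constant $C>0$ such that the following holds. Given any graph $G$ with vertex set $\{0,\dots,n-1\}$ (as its number of vertices $n$ and its adjacency matrix), any real $\lambda>0$ and any real $\varepsilon\in(0,1)$, the algorithm halts and returns an $\varepsilon$-approximation of $Z_\lambda(G)$. Moreover, if $n\ge 2$, then for every integer $\Delta\ge 2$ such that $G$ has maximum degree at most $\Delta$, its running time is at most $$\left(\frac n\varepsilon\right)^{C\,\max\{1,\sqrt{\lambda\Delta}\}\,\log\Delta}.$$ In particular, the running time is $\left(\frac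 n\varepsilon\right)^{O(\sqrt{\lambda\Delta}\,\log\Delta)}$, with an absolute constant in the $O(\cdot)$ if $\lambda\Delta\ge 1$, and with a constant that depends only on $\lambda$ for any fixed $\lambda>0$. -/

import Mathlib

noncomputable section

/-! Matchings of a graph and their partition function. -/

namespace MonomerDimer

variable {V : Type*}

/-- A matching of `G`: a finite set of edges of `G`, any two distinct ones of which share no
vertex. -/
def IsMatching (G : SimpleGraph V) (M : Finset (Sym2 V)) : Prop :=
  (∀ e ∈ M, e ∈ G.edgeSet) ∧ ∀ e ∈ M, ∀ f ∈ M, e ≠ f → ∀ v : V, ¬ (v ∈ e ∧ v ∈ f)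

open Classical in
/-- The partition function: the sum of `lam ^ |M|` over all matchings `M` of `G`. -/
def partitionFunction [Fintype V] (G : SimpleGraph V) (lam : ℝ) : ℝ :=
  ∑ M : Finset (Sym2 V) with IsMatching G M, lam ^ M.card

/-- `Zhat` is an `eps`-approximation of `Z`. -/
def IsApprox (eps Zhat Z : ℝ) : Prop :=
  (1 - eps) * Z ≤ Zhat ∧ Zhat ≤ (1 + eps) * Z

end MonomerDimer

/-! A deterministic random access machine with exact real arithmetic (real RAM), programmed by
structured programs, with unit cost per instruction and per test. Registers are addressed directly
by the program; memory cells are addressed indirectly, through registers. Natural numbers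
serve for indexing and only have addition and truncated subtraction; reals have the four
arithmetic operations and comparison, and there is no rounding and no conversion of reals to
natural numbers. The constants of a program are natural and rational numbers. -/

namespace RealRAM

/-- Registers and memory, for natural numbers and for real numbers. -/
structure State where
  reg : ℕ → ℕ
  mem : ℕ → ℕ
  rreg : ℕ → ℝ
  rmem : ℕ → ℝ

/-- The elementary instructions; their first argument is the target. -/
inductive Instr where
  | const (x c : ℕ)
  | add (x y z : ℕ)
  | sub (x y z : ℕ)
  | load (x y : ℕ)
  | store (x y : ℕ)
  | rconst (x : ℕ) (c : ℚ)
  | radd (x y z : ℕ)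
  | rsub (x y z : ℕ)
  | rmul (x y z : ℕ)
  | rdiv (x y z : ℕ)
  | rload (x y : ℕ)
  | rstore (x y : ℕ)

/-- The effect of an elementary instruction. Division by zero gives zero. -/
def Instr.exec (s : State) : Instr → State
  | .const x c => { s with reg := Function.update s.reg x c }
  | .add x y z => { s with reg := Function.update s.reg x (s.reg y + s.reg z) }
  | .sub x y z => { s with reg := Function.update s.reg x (s.reg y - s.reg z) }
  | .load x y => { s with reg := Function.update s.reg x (s.mem (s.reg y)) }
  | .store x y => { s with mem := Function.update s.mem (s.reg x) (s.reg y) }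
  | .rconst x c => { s with rreg := Function.update s.rreg x (c : ℝ) }
  | .radd x y z => { s with rreg := Function.update s.rreg x (s.rreg y + s.rreg z) }
  | .rsub x y z => { s with rreg := Function.update s.rreg x (s.rreg y - s.rreg z) }
  | .rmul x y z => { s with rreg := Function.update s.rreg x (s.rreg y * s.rreg z) }
  | .rdiv x y z => { s with rreg := Function.update s.rreg x (s.rreg y / s.rreg z) }
  | .rload x y => { s with rreg := Function.update s.rreg x (s.rmem (s.reg y)) }
  | .rstore x y => { s with rmem := Function.update s.rmem (s.reg x) (s.rreg y) }

/-- The elementary tests: comparison of two natural registers or of two real registers. -/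
inductive Test where
  | lt (x y : ℕ)
  | rle (x y : ℕ)

/-- When a test succeeds. -/
def Test.Holds (s : State) : Test → Prop
  | .lt x y => s.reg x < s.reg y
  | .rle x y => s.rreg x ≤ s.rreg y

/-- Programs. -/
inductive Prog where
  | skip
  | instr (i : Instr)
  | seq (p q : Prog)
  | ite (t : Test) (p q : Prog)
  | while (t : Test) (p : Prog)

open Classical in
/-- One step of the machine, on a list of programs that remain to be executed one after the
other and the current state. The machine has halted when the list is empty. -/
def step : List Prog × State → List Prog × State
  | ([], s) => ([], s)
  | (.skip :: k, s) => (k, s)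
  | (.instr i :: k, s) => (k, i.exec s)
  | (.seq p q :: k, s) => (p :: q :: k, s)
  | (.ite t p q :: k, s) => if t.Holds s then (p :: k, s) else (q :: k, s)
  | (.while t p :: k, s) => if t.Holds s then (p :: .while t p :: k, s) else (k, s)

/-- Started in state `s`, the program `P` halts within `T` steps, in state `s'`. -/
def HaltsWithin (P : Prog) (s : State) (T : ℕ) (s' : State) : Prop :=
  step^[T] ([P], s) = ([], s')

/-- The initial state on input `(G, lam, eps)`, where `G` is a graph with vertices
`0, …, n - 1`: register `0` holds `n`, the memory cells `i * n + j` with `i, j < n` hold the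
adjacency matrix of `G`, the real registers `0` and `1` hold `lam` and `eps`, and everything
else is zero. -/
def input {n : ℕ} (G : SimpleGraph (Fin n)) [DecidableRel G.Adj] (lam eps : ℝ) : State where
  reg := fun x => if x = 0 then n else 0
  mem := fun a => if h : a < n * n then
      (if G.Adj ⟨a / n, Nat.div_lt_of_lt_mul h⟩
        ⟨a % n, Nat.mod_lt a (Nat.pos_of_mul_pos_left (Nat.zero_lt_of_lt h))⟩ then 1 else 0)
    else 0
  rreg := fun x => if x = 0 then lam else if x = 1 then eps else 0
  rmem := fun _ => 0

/-- The output is the content of the real register `0`. -/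
def State.output (s : State) : ℝ := s.rreg 0

end RealRAM

end

noncomputable section

/-! Add the vertices one at a time: Z is the telescoping product of the ratios of partition
functions on {0, …, m} and {0, …, m - 1}. The inverse of such a ratio is the probability that m is
uncovered. Conditioning on the partner of v writes this probability as 1 / (1 + λ Σ p_u), where u
runs over the neighbours of v and p_u is the same kind of probability after v is deleted
(`uncovered_eq`). The right side decreases in each p_u, so cutting the recursion off at depth t with
the value 1 gives upper and lower bounds alternately, and consecutive estimates bracket Z
(`estimate_alternates`). It is therefore sound to increase t until two consecutive estimates agree
up to the factor 1 + ε. This stopping rule needs neither Δ nor a precomputed depth, and it applies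
at depth n at the latest, where the recursion is exact.

The degree bound enters only the analysis. With q = √(1 + λΔ), two levels of the recursion multiply
the logarithm of the worst ratio by at most (q - 1) / (q + 1) (`contraction`), so the rule applies
at some depth O(max(1, √(λΔ)) log(n/ε)) (`exists_close_estimate`).

A depth first search over self-avoiding paths evaluates the recursion in about Δ^t steps, up to
polynomial factors (`visit_loops`). The running time follows from Δ^(c log(n/ε)) = (n/ε)^(c log Δ).
-/

namespace MonomerDimer

variable {V : Type*}

/-! ### Matchings of induced subgraphs and their recursion -/

open Classical in
/-- The matchings of `G` all of whose edges lie in `U`. -/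
def matchingsOn (G : SimpleGraph V) (U : Finset V) : Finset (Finset (Sym2 V)) :=
  U.sym2.powerset.filter (IsMatching G)

/-- The partition function of the subgraph of `G` induced on `U`. -/
def partitionFunctionOn (G : SimpleGraph V) (lam : ℝ) (U : Finset V) : ℝ :=
  ∑ M ∈ matchingsOn G U, lam ^ M.card

open Classical in
/-- The neighbours of `v` in `U`. -/
def nbrs (G : SimpleGraph V) (U : Finset V) (v : V) : Finset V := U.filter (G.Adj v)

theorem mem_nbrs {G : SimpleGraph V} {U : Finset V} {u v : V} :
    u ∈ nbrs G U v ↔ u ∈ U ∧ G.Adj v u := by simp [nbrs]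

theorem mem_matchingsOn {G : SimpleGraph V} {U : Finset V} {M : Finset (Sym2 V)} :
    M ∈ matchingsOn G U ↔ (∀ e ∈ M, ∀ v ∈ e, v ∈ U) ∧ IsMatching G M := by
  simp [matchingsOn, Finset.subset_iff, Finset.mem_sym2_iff]

theorem IsMatching.subset {G : SimpleGraph V} {M N : Finset (Sym2 V)} (h : IsMatching G M)
    (hN : N ⊆ M) : IsMatching G N :=
  ⟨fun e he => h.1 e (hN he), fun e he f hf => h.2 e (hN he) f (hN hf)⟩

theorem partitionFunctionOn_univ [Fintype V] (G : SimpleGraph V) (lam : ℝ) :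
    partitionFunctionOn G lam Finset.univ = partitionFunction G lam := by
  unfold partitionFunctionOn partitionFunction
  refine Finset.sum_congr ?_ fun _ _ => rfl
  ext M
  simp [mem_matchingsOn]

theorem matchingsOn_empty (G : SimpleGraph V) : matchingsOn G ∅ = {∅} := by
  ext M
  rw [mem_matchingsOn, Finset.mem_singleton]
  constructor
  · rintro ⟨h, -⟩
    refine Finset.eq_empty_of_forall_notMem fun e he => ?_
    induction e with | _ a b => simpa using h _ he a
  · rintro rfl
    simp [IsMatching]

theorem partitionFunctionOn_empty (G : SimpleGraph V) (lam : ℝ) :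
    partitionFunctionOn G lam ∅ = 1 := by
  simp [partitionFunctionOn, matchingsOn_empty]

theorem notMem_of_mem_matchingsOn {G : SimpleGraph V} {U : Finset V} {M : Finset (Sym2 V)}
    (hM : M ∈ matchingsOn G U) {u v : V} (hv : v ∉ U) : s(v, u) ∉ M :=
  fun h => hv ((mem_matchingsOn.1 hM).1 _ h v (Sym2.mem_mk_left v u))

theorem partitionFunctionOn_pos (G : SimpleGraph V) {lam : ℝ} (hlam : 0 < lam) (U : Finset V) :
    0 < partitionFunctionOn G lam U := by
  refine Finset.sum_pos (fun M _ => pow_pos hlam _) ⟨∅, mem_matchingsOn.2 ?_⟩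
  simp [IsMatching]

variable [DecidableEq V]

/-- The recursion for the probability that `v` is not covered by a random matching of the
subgraph induced on `insert v U`, truncated at depth `t`. -/
def approx (G : SimpleGraph V) (lam : ℝ) : ℕ → Finset V → V → ℝ
  | 0, _, _ => 1
  | t + 1, U, v => 1 / (1 + lam * ∑ u ∈ nbrs G U v, approx G lam t (U.erase u) u)

/-- Either v is uncovered or it is matched to a unique neighbour u; in the latter case, removing the
edge leaves a matching that avoids both v and u. -/
theorem matchingsOn_insert (G : SimpleGraph V) {U : Finset V} {v : V} (hv : v ∉ U) :
    matchingsOn G (insert v U) = matchingsOn G U ∪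
      (nbrs G U v).biUnion fun u => (matchingsOn G (U.erase u)).image (insert s(v, u)) := by
  ext M
  simp only [Finset.mem_union, Finset.mem_biUnion, Finset.mem_image, mem_nbrs]
  constructor
  · intro hM
    obtain ⟨hU, hm⟩ := mem_matchingsOn.1 hM
    by_cases hc : ∃ e ∈ M, v ∈ e
    · right
      obtain ⟨e, he, hve⟩ := hc
      obtain ⟨u, rfl⟩ := Sym2.mem_iff_exists.1 hve
      have hadj : G.Adj v u := by simpa using hm.1 _ he
      have hu : u ∈ U := by
        have := hU _ he u (Sym2.mem_mk_right v u)
        exact (Finset.mem_insert.1 this).resolve_left hadj.ne'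
      refine ⟨u, ⟨hu, hadj⟩, M.erase s(v, u), ?_, Finset.insert_erase he⟩
      refine mem_matchingsOn.2 ⟨fun f hf w hw => ?_, hm.subset (Finset.erase_subset _ _)⟩
      have hfM := Finset.mem_of_mem_erase hf
      have hne := Finset.ne_of_mem_erase hf
      have hwv : w ≠ v := by
        rintro rfl
        exact hm.2 _ hfM _ he hne w ⟨hw, Sym2.mem_mk_left _ _⟩
      have hwu : w ≠ u := by
        rintro rfl
        exact hm.2 _ hfM _ he hne w ⟨hw, Sym2.mem_mk_right _ _⟩
      exact Finset.mem_erase.2 ⟨hwu, (Finset.mem_insert.1 (hU _ hfM w hw)).resolve_left hwv⟩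
    · left
      refine mem_matchingsOn.2 ⟨fun e he w hw => ?_, hm⟩
      refine (Finset.mem_insert.1 (hU e he w hw)).resolve_left ?_
      rintro rfl
      exact hc ⟨e, he, hw⟩
  · rintro (hM | ⟨u, ⟨hu, hadj⟩, N, hN, rfl⟩)
    · obtain ⟨hU, hm⟩ := mem_matchingsOn.1 hM
      exact mem_matchingsOn.2 ⟨fun e he w hw => Finset.mem_insert_of_mem (hU e he w hw), hm⟩
    · obtain ⟨hU, hm⟩ := mem_matchingsOn.1 hN
      have key : ∀ f ∈ N, ∀ w, w ∈ f → w ∉ s(v, u) := by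
        intro f hf w hw hw'
        have := Finset.mem_erase.1 (hU f hf w hw)
        rcases Sym2.mem_iff.1 hw' with rfl | rfl
        · exact hv this.2
        · exact this.1 rfl
      refine mem_matchingsOn.2 ⟨fun e he w hw => ?_, fun e he => ?_, fun e he f hf hne w hw => ?_⟩
      · rcases Finset.mem_insert.1 he with rfl | he
        · rcases Sym2.mem_iff.1 hw with rfl | rfl
          · exact Finset.mem_insert_self _ _
          · exact Finset.mem_insert_of_mem hu
        · exact Finset.mem_insert_of_mem (Finset.mem_of_mem_erase (hU e he w hw))
      · rcases Finset.mem_insert.1 he with rfl | he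
        · exact hadj
        · exact hm.1 e he
      · rcases Finset.mem_insert.1 he with rfl | he' <;> rcases Finset.mem_insert.1 hf with rfl | hf'
        · exact hne rfl
        · exact key f hf' w hw.2 hw.1
        · exact key e he' w hw.1 hw.2
        · exact hm.2 e he' f hf' hne w hw

theorem partitionFunctionOn_insert (G : SimpleGraph V) (lam : ℝ) {U : Finset V} {v : V}
    (hv : v ∉ U) : partitionFunctionOn G lam (insert v U) = partitionFunctionOn G lam U +
      lam * ∑ u ∈ nbrs G U v, partitionFunctionOn G lam (U.erase u) := by
  have hv' : ∀ u, v ∉ U.erase u := fun u h => hv (Finset.mem_of_mem_erase h)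
  unfold partitionFunctionOn
  rw [matchingsOn_insert G hv, Finset.sum_union, Finset.sum_biUnion, Finset.mul_sum]
  · congr 1
    refine Finset.sum_congr rfl fun u _ => ?_
    rw [Finset.sum_image, Finset.mul_sum]
    · refine Finset.sum_congr rfl fun M hM => ?_
      rw [Finset.card_insert_of_notMem (notMem_of_mem_matchingsOn hM (hv' u)), pow_succ']
    · intro M hM N hN h
      rw [← Finset.erase_insert (notMem_of_mem_matchingsOn hM (hv' u)), h,
        Finset.erase_insert (notMem_of_mem_matchingsOn hN (hv' u))]
  · intro u _ w _ huw
    refine Finset.disjoint_left.2 fun M hM hN => ?_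
    obtain ⟨M, hM', rfl⟩ := Finset.mem_image.1 hM
    obtain ⟨N, hN', h⟩ := Finset.mem_image.1 hN
    have : s(v, w) ∈ insert s(v, u) M := h ▸ Finset.mem_insert_self _ _
    rcases Finset.mem_insert.1 this with h | h
    · exact huw (Sym2.congr_right.1 h).symm
    · exact notMem_of_mem_matchingsOn hM' (hv' u) h
  · refine Finset.disjoint_left.2 fun M hM hN => ?_
    obtain ⟨u, -, hN⟩ := Finset.mem_biUnion.1 hN
    obtain ⟨N, -, rfl⟩ := Finset.mem_image.1 hN
    exact notMem_of_mem_matchingsOn hM hv (Finset.mem_insert_self _ _)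

/-- Both sides obey the recursion of `partitionFunctionOn_insert`, so induction on the vertex set
replaces an explicit bijection of matchings. -/
theorem partitionFunctionOn_map {W : Type*} [DecidableEq W] (G : SimpleGraph V) (f : V ↪ W)
    (lam : ℝ) (U : Finset V) :
    partitionFunctionOn (G.map f) lam (U.map f) = partitionFunctionOn G lam U := by
  induction U using Finset.strongInduction with
  | H U ih =>
    rcases U.eq_empty_or_nonempty with rfl | ⟨v, hv⟩
    · simp [partitionFunctionOn_empty]
    · have h1 := Finset.erase_ssubset hv
      have hn : nbrs (G.map f) ((U.erase v).map f) (f v) = (nbrs G (U.erase v) v).map f := by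
        ext w
        simp only [mem_nbrs, Finset.mem_map]
        constructor
        · rintro ⟨⟨u, hu, rfl⟩, h⟩
          exact ⟨u, ⟨hu, by simpa using h⟩, rfl⟩
        · rintro ⟨u, ⟨hu, h⟩, rfl⟩
          exact ⟨⟨u, hu, rfl⟩, by simpa using h⟩
      rw [← Finset.insert_erase hv, Finset.map_insert,
        partitionFunctionOn_insert _ _ (by simp), partitionFunctionOn_insert _ _ (by simp), ih _ h1,
        hn, Finset.sum_map]
      congr 2
      refine Finset.sum_congr rfl fun u _ => ?_
      rw [← Finset.map_erase]
      exact ih _ ((Finset.erase_subset _ _).trans_ssubset h1)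

/-! ### Uncovered probabilities and their truncated recursion -/

/-- The probability that `v` is not covered by a random matching of the subgraph induced on
`insert v U`. -/
def uncovered (G : SimpleGraph V) (lam : ℝ) (U : Finset V) (v : V) : ℝ :=
  partitionFunctionOn G lam U / partitionFunctionOn G lam (insert v U)

theorem uncovered_pos (G : SimpleGraph V) {lam : ℝ} (hlam : 0 < lam) (U : Finset V) (v : V) :
    0 < uncovered G lam U v :=
  div_pos (partitionFunctionOn_pos G hlam _) (partitionFunctionOn_pos G hlam _)

theorem uncovered_eq (G : SimpleGraph V) {lam : ℝ} (hlam : 0 < lam) {U : Finset V} {v : V}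
    (hv : v ∉ U) : uncovered G lam U v =
      1 / (1 + lam * ∑ u ∈ nbrs G U v, uncovered G lam (U.erase u) u) := by
  have hU := (partitionFunctionOn_pos G hlam U).ne'
  have : ∑ u ∈ nbrs G U v, uncovered G lam (U.erase u) u =
      (∑ u ∈ nbrs G U v, partitionFunctionOn G lam (U.erase u)) / partitionFunctionOn G lam U := by
    rw [Finset.sum_div]
    refine Finset.sum_congr rfl fun u hu => ?_
    rw [uncovered, Finset.insert_erase (mem_nbrs.1 hu).1]
  rw [this, uncovered, partitionFunctionOn_insert G lam hv]
  field_simp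

theorem approx_pos (G : SimpleGraph V) {lam : ℝ} (hlam : 0 < lam) (t : ℕ) (U : Finset V) (v : V) :
    0 < approx G lam t U v := by
  induction t generalizing U v with
  | zero => exact one_pos
  | succ t ih =>
    have := Finset.sum_nonneg fun u (_ : u ∈ nbrs G U v) => (ih (U.erase u) u).le
    rw [approx]
    positivity

theorem approx_le_one (G : SimpleGraph V) {lam : ℝ} (hlam : 0 < lam) (t : ℕ) (U : Finset V)
    (v : V) : approx G lam t U v ≤ 1 := by
  cases t with
  | zero => exact le_rfl
  | succ t =>
    have := Finset.sum_nonneg fun u (_ : u ∈ nbrs G U v) => (approx_pos G hlam t (U.erase u) u).le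
    rw [approx]
    exact div_le_one_of_le₀ (by nlinarith) (by positivity)

/-- The value 1 at depth 0 bounds every probability from above, and each level of the recursion
reverses inequalities. -/
theorem approx_alternates (G : SimpleGraph V) {lam : ℝ} (hlam : 0 < lam) (t : ℕ) {U : Finset V}
    {v : V} (hv : v ∉ U) : (Even t → uncovered G lam U v ≤ approx G lam t U v) ∧
      (Odd t → approx G lam t U v ≤ uncovered G lam U v) := by
  induction t generalizing U v with
  | zero =>
    refine ⟨fun _ => ?_, fun h => by simp at h⟩
    have := Finset.sum_nonneg fun u (_ : u ∈ nbrs G U v) => (uncovered_pos G hlam (U.erase u) u).le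
    rw [uncovered_eq G hlam hv, approx]
    exact div_le_one_of_le₀ (by nlinarith) (by positivity)
  | succ t ih =>
    have ih' := fun u => @ih (U.erase u) u (Finset.notMem_erase u U)
    have h1 := Finset.sum_nonneg fun u (_ : u ∈ nbrs G U v) =>
      (uncovered_pos G hlam (U.erase u) u).le
    have h2 := Finset.sum_nonneg fun u (_ : u ∈ nbrs G U v) => (approx_pos G hlam t (U.erase u) u).le
    rw [uncovered_eq G hlam hv, approx]
    constructor
    · intro ht
      have ht : Odd t := by
        rcases Nat.even_or_odd t with h | h
        · exact absurd ht (by simpa using h.add_one)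
        · exact h
      have := Finset.sum_le_sum fun u (_ : u ∈ nbrs G U v) => (ih' u).2 ht
      gcongr
    · intro ht
      have ht : Even t := by
        rcases Nat.even_or_odd t with h | h
        · exact h
        · exact absurd ht (by simpa using h.add_one)
      have := Finset.sum_le_sum fun u (_ : u ∈ nbrs G U v) => (ih' u).1 ht
      gcongr

/-- Each level removes a vertex from U, so the recursion runs out of vertices before the cut-off
matters. This is what makes the algorithm halt on every input. -/
theorem approx_eq_uncovered (G : SimpleGraph V) {lam : ℝ} (hlam : 0 < lam) (t : ℕ) {U : Finset V}
    {v : V} (hv : v ∉ U) (ht : U.card ≤ t) : approx G lam t U v = uncovered G lam U v := by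
  induction t generalizing U v with
  | zero =>
    obtain rfl : U = ∅ := by simpa using ht
    rw [uncovered_eq G hlam hv]
    simp [approx, nbrs]
  | succ t ih =>
    rw [uncovered_eq G hlam hv, approx]
    congr 3
    refine Finset.sum_congr rfl fun u hu => ih (Finset.notMem_erase u U) ?_
    rw [Finset.card_erase_of_mem (mem_nbrs.1 hu).1]
    omega

/-! ### Estimates of the partition function and the stopping rule -/

/-- The estimate of the partition function of the subgraph induced on `0, …, n - 1`, with
recursions truncated at depth `t`. -/
def estimate (H : SimpleGraph ℕ) (lam : ℝ) (t n : ℕ) : ℝ :=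
  ∏ m ∈ Finset.range n, 1 / approx H lam t (Finset.range m) m

theorem partitionFunctionOn_range (H : SimpleGraph ℕ) {lam : ℝ} (hlam : 0 < lam) (n : ℕ) :
    partitionFunctionOn H lam (Finset.range n) =
      ∏ m ∈ Finset.range n, 1 / uncovered H lam (Finset.range m) m := by
  induction n with
  | zero => simp [partitionFunctionOn_empty]
  | succ n ih =>
    rw [Finset.prod_range_succ, ← ih, uncovered, Finset.range_add_one]
    have := (partitionFunctionOn_pos H hlam (Finset.range n)).ne'
    field_simp

theorem estimate_pos (H : SimpleGraph ℕ) {lam : ℝ} (hlam : 0 < lam) (t n : ℕ) :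
    0 < estimate H lam t n :=
  Finset.prod_pos fun m _ => one_div_pos.2 (approx_pos H hlam t _ m)

theorem estimate_alternates (H : SimpleGraph ℕ) {lam : ℝ} (hlam : 0 < lam) (t n : ℕ) :
    (Even t → estimate H lam t n ≤ partitionFunctionOn H lam (Finset.range n)) ∧
      (Odd t → partitionFunctionOn H lam (Finset.range n) ≤ estimate H lam t n) := by
  have h := fun m => approx_alternates H hlam t (Finset.notMem_range_self (n := m))
  rw [partitionFunctionOn_range H hlam]
  constructor <;> intro ht <;>
    refine Finset.prod_le_prod (fun m _ => one_div_nonneg.2 ?_) fun m _ => ?_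
  · exact (approx_pos H hlam t _ m).le
  · exact one_div_le_one_div_of_le (uncovered_pos H hlam _ m) ((h m).1 ht)
  · exact (uncovered_pos H hlam _ m).le
  · exact one_div_le_one_div_of_le (approx_pos H hlam t _ m) ((h m).2 ht)

theorem estimate_eq (H : SimpleGraph ℕ) {lam : ℝ} (hlam : 0 < lam) {t n : ℕ} (ht : n ≤ t) :
    estimate H lam t n = partitionFunctionOn H lam (Finset.range n) := by
  rw [partitionFunctionOn_range H hlam]
  refine Finset.prod_congr rfl fun m hm => ?_
  have := Finset.mem_range.1 hm
  rw [approx_eq_uncovered H hlam t Finset.notMem_range_self (by simp; omega)]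

/-- The stopping condition: two consecutive estimates agree up to a factor `1 + eps`. -/
def Close (eps x y : ℝ) : Prop := y ≤ (1 + eps) * x ∧ x ≤ (1 + eps) * y

/-- The two estimates lie on opposite sides of Z. If the later one is the lower, it is at least Z /
(1 + eps), hence at least (1 - eps) Z. -/
theorem isApprox_of_close (H : SimpleGraph ℕ) {lam eps : ℝ} (hlam : 0 < lam) (heps : 0 < eps)
    {t n : ℕ} (h : Close eps (estimate H lam t n) (estimate H lam (t + 1) n)) :
    IsApprox eps (estimate H lam (t + 1) n) (partitionFunctionOn H lam (Finset.range n)) := by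
  have h1 := estimate_alternates H hlam t n
  have h2 := estimate_alternates H hlam (t + 1) n
  have hp := estimate_pos H hlam t n
  have hp' := estimate_pos H hlam (t + 1) n
  have hZ := partitionFunctionOn_pos H hlam (Finset.range n)
  obtain ⟨h3, h4⟩ := h
  rcases Nat.even_or_odd t with ht | ht
  · have h1 := h1.1 ht
    have h2 := h2.2 ht.add_one
    constructor <;> nlinarith
  · have h1 := h1.2 ht
    have h2 := h2.1 ht.add_one
    refine ⟨?_, by nlinarith⟩
    by_cases he : eps ≤ 1
    · nlinarith
    · nlinarith


/-! ### Contraction of the recursion in logarithmic scale -/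

theorem contraction_deriv {ι : Type*} (s : Finset ι) {lam q : ℝ} (hlam : 0 < lam) (hq : 1 < q)
    (hcard : lam * s.card ≤ q ^ 2 - 1) (x : ι → ℝ) :
    lam * ∑ i ∈ s, x i * (1 - x i) ≤ (q - 1) / (q + 1) * (1 + lam * ∑ i ∈ s, x i) := by
  have hcs : (∑ i ∈ s, x i) ^ 2 ≤ s.card * ∑ i ∈ s, x i ^ 2 := sq_sum_le_card_mul_sum_sq
  have hsum : ∑ i ∈ s, x i * (1 - x i) = ∑ i ∈ s, x i - ∑ i ∈ s, x i ^ 2 := by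
    rw [← Finset.sum_sub_distrib]
    exact Finset.sum_congr rfl fun i _ => by ring
  have hy : 0 ≤ ∑ i ∈ s, x i ^ 2 := Finset.sum_nonneg fun i _ => sq_nonneg _
  rw [hsum, div_mul_eq_mul_div, le_div_iff₀ (by linarith)]
  set S := ∑ i ∈ s, x i
  set Y := ∑ i ∈ s, x i ^ 2
  have h1 : (lam * S) ^ 2 ≤ (q ^ 2 - 1) * (lam * Y) := by
    calc (lam * S) ^ 2 = lam ^ 2 * S ^ 2 := by ring
      _ ≤ lam ^ 2 * (s.card * Y) := by gcongr
      _ = (lam * s.card) * (lam * Y) := by ring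
      _ ≤ _ := by gcongr
  -- By `h1` (Cauchy–Schwarz), the product is at least the square of lam * S - (q - 1).
  have h2 : 0 ≤ (q - 1) * ((q - 1) - 2 * (lam * S) + (q + 1) * (lam * Y)) := by
    nlinarith [sq_nonneg (lam * S - q + 1)]
  have h3 := nonneg_of_mul_nonneg_right h2 (by linarith)
  nlinarith

/-- Two levels of the recursion contract ratios, in logarithmic scale, by `(q - 1) / (q + 1)`. -/
theorem contraction {ι : Type*} (s : Finset ι) {lam q : ℝ} (hlam : 0 < lam) (hq : 1 < q)
    (hcard : lam * s.card ≤ q ^ 2 - 1) {A B : ι → ℝ} (hA : ∀ i ∈ s, 0 ≤ A i)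
    (hB : ∀ i ∈ s, 0 ≤ B i) {r : ℝ} (hr : 1 ≤ r) (hAB : ∀ i ∈ s, B i ≤ r * A i) :
    1 + lam * ∑ i ∈ s, 1 / (1 + A i) ≤
      r ^ ((q - 1) / (q + 1)) * (1 + lam * ∑ i ∈ s, 1 / (1 + B i)) := by
  set κ := (q - 1) / (q + 1) with hκ
  -- It suffices that h increases on [1, ∞): h 1 is the left side, and h r is at most the right side
  -- because B ≤ r A. For x = 1 / (1 + y A) one has y dx/dy = -x (1 - x), so the sign of the
  -- derivative of h is given by `contraction_deriv`.
  set h : ℝ → ℝ := fun y => y ^ κ * (1 + lam * ∑ i ∈ s, 1 / (1 + y * A i)) with hh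
  have hpos : ∀ y : ℝ, 1 ≤ y → ∀ i ∈ s, 0 < 1 + y * A i := fun y hy i hi => by
    have := hA i hi
    positivity
  have hder : ∀ y : ℝ, 1 ≤ y → HasDerivAt h
      (κ * y ^ (κ - 1) * (1 + lam * ∑ i ∈ s, 1 / (1 + y * A i)) +
        y ^ κ * (lam * ∑ i ∈ s, -A i / (1 + y * A i) ^ 2)) y := by
    intro y hy
    have hs : HasDerivAt (fun y => ∑ i ∈ s, 1 / (1 + y * A i))
        (∑ i ∈ s, -A i / (1 + y * A i) ^ 2) y := by
      refine HasDerivAt.fun_sum fun i hi => ?_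
      have h1 : HasDerivAt (fun y => 1 + y * A i) (A i) y := by
        simpa using ((hasDerivAt_id y).mul_const (A i)).const_add 1
      simpa only [one_div] using h1.fun_inv (hpos y hy i hi).ne'
    exact (Real.hasDerivAt_rpow_const (Or.inl (by positivity))).mul ((hs.const_mul lam).const_add 1)
  have hmono : MonotoneOn h (Set.Ici 1) := by
    refine monotoneOn_of_deriv_nonneg (convex_Ici 1)
      (fun y hy => (hder y hy).continuousAt.continuousWithinAt)
      (fun y hy => (hder y (interior_subset hy)).differentiableAt.differentiableWithinAt) ?_
    intro y hy
    have hy : 1 ≤ y := interior_subset hy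
    have hy0 : 0 < y := by positivity
    rw [(hder y hy).deriv]
    have hd := contraction_deriv s hlam hq hcard fun i => 1 / (1 + y * A i)
    have he : ∑ i ∈ s, 1 / (1 + y * A i) * (1 - 1 / (1 + y * A i)) =
        - (y * ∑ i ∈ s, -A i / (1 + y * A i) ^ 2) := by
      rw [Finset.mul_sum, ← Finset.sum_neg_distrib]
      refine Finset.sum_congr rfl fun i hi => ?_
      have := (hpos y hy i hi).ne'
      field_simp
      ring
    rw [he] at hd
    have hyk : y ^ κ = y ^ (κ - 1) * y := by
      rw [← Real.rpow_add_one hy0.ne', sub_add_cancel]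
    rw [hyk]
    have := Real.rpow_pos_of_pos hy0 (κ - 1)
    calc 0 ≤ y ^ (κ - 1) * (κ * (1 + lam * ∑ i ∈ s, 1 / (1 + y * A i)) -
          lam * -(y * ∑ i ∈ s, -A i / (1 + y * A i) ^ 2)) :=
          mul_nonneg this.le (sub_nonneg.2 hd)
      _ = _ := by ring
  have h1 := hmono (Set.mem_Ici.2 le_rfl) (Set.mem_Ici.2 hr) hr
  simp only [hh, one_mul, Real.one_rpow] at h1
  refine h1.trans ?_
  have hle : ∑ i ∈ s, 1 / (1 + r * A i) ≤ ∑ i ∈ s, 1 / (1 + B i) :=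
    Finset.sum_le_sum fun i hi => one_div_le_one_div_of_le (by linarith [hB i hi])
      (by linarith [hAB i hi])
  gcongr

/-- Depths 0 and 1 differ at most by the factor 1 + lam * deg ≤ q ^ 2, and every further pair of
levels raises the factor to the power (q - 1) / (q + 1). -/
theorem approx_ratio {V : Type*} [DecidableEq V] (G : SimpleGraph V) {lam q : ℝ} (hlam : 0 < lam)
    (hq : 1 < q) (hdeg : ∀ U v, lam * (nbrs G U v).card ≤ q ^ 2 - 1) (k : ℕ) (U : Finset V) (v : V) :
    approx G lam (2 * k) U v ≤
        (q ^ 2) ^ (((q - 1) / (q + 1)) ^ k) * approx G lam (2 * k + 1) U v ∧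
      approx G lam (2 * k + 1) U v ≤
        (q ^ 2) ^ (((q - 1) / (q + 1)) ^ k) * approx G lam (2 * k) U v := by
  have hq2 : (1 : ℝ) ≤ q ^ 2 := by nlinarith
  induction k generalizing U v with
  | zero =>
    have h1 := approx_le_one G hlam 1 U v
    simp only [pow_zero, Real.rpow_one, mul_zero, zero_add]
    refine ⟨?_, by simp only [approx] at h1 ⊢; linarith⟩
    have h0 : (0 : ℝ) ≤ lam * (nbrs G U v).card := by positivity
    simp only [approx, Finset.sum_const, nsmul_eq_mul, mul_one]
    rw [mul_one_div, le_div_iff₀ (by linarith)]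
    linarith [hdeg U v]
  | succ k ih =>
    set κ := (q - 1) / (q + 1) with hκ
    have hκ0 : 0 ≤ κ := div_nonneg (by linarith) (by linarith)
    have hr : 1 ≤ (q ^ 2) ^ (κ ^ k) := Real.one_le_rpow hq2 (by positivity)
    rw [pow_succ κ k, Real.rpow_mul (by positivity)]
    generalize (q ^ 2) ^ (κ ^ k) = r at *
    have hn : ∀ t u, 0 ≤ lam * ∑ w ∈ nbrs G (U.erase u) u, approx G lam t ((U.erase u).erase w) w :=
      fun t u => mul_nonneg hlam.le (Finset.sum_nonneg fun w _ => (approx_pos G hlam _ _ _).le)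
    have key : ∀ t t', (∀ U v, approx G lam t' U v ≤ r * approx G lam t U v) →
        approx G lam (t' + 2) U v ≤ r ^ κ * approx G lam (t + 2) U v := by
      intro t t' h
      have := contraction (nbrs G U v) hlam hq (hdeg U v) (fun u _ => hn t u) (fun u _ => hn t' u) hr
        (fun u _ => ?_)
      · have hp := fun t => approx_pos G hlam (t + 2) U v
        simp only [approx] at hp ⊢
        rw [mul_one_div, div_le_div_iff₀ (one_div_pos.1 (hp t')) (one_div_pos.1 (hp t)), one_mul]
        exact this
      · rw [mul_left_comm]
        refine mul_le_mul_of_nonneg_left ?_ hlam.le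
        rw [Finset.mul_sum]
        exact Finset.sum_le_sum fun w _ => h _ _
    exact ⟨key (2 * k + 1) (2 * k) fun U v => (ih U v).1,
      key (2 * k) (2 * k + 1) fun U v => (ih U v).2⟩

/-! ### A depth that suffices -/

theorem estimate_le_of_approx_le (H : SimpleGraph ℕ) {lam r : ℝ} (hlam : 0 < lam) {t t' : ℕ}
    (h : ∀ U v, approx H lam t U v ≤ r * approx H lam t' U v) (n : ℕ) :
    estimate H lam t' n ≤ r ^ n * estimate H lam t n := by
  calc estimate H lam t' n ≤ ∏ m ∈ Finset.range n, r * (1 / approx H lam t (Finset.range m) m) := by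
        refine Finset.prod_le_prod (fun m _ => one_div_nonneg.2 (approx_pos H hlam _ _ _).le)
          fun m _ => ?_
        rw [mul_one_div, div_le_div_iff₀ (approx_pos H hlam _ _ _) (approx_pos H hlam _ _ _), one_mul]
        exact h _ _
    _ = _ := by simp [Finset.prod_mul_distrib, estimate]

theorem close_estimate_of_le (H : SimpleGraph ℕ) {lam eps q : ℝ} (hlam : 0 < lam) (hq : 1 < q)
    (hdeg : ∀ U v, lam * (nbrs H U v).card ≤ q ^ 2 - 1) (n k : ℕ)
    (h : ((q ^ 2) ^ (((q - 1) / (q + 1)) ^ k)) ^ n ≤ 1 + eps) :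
    Close eps (estimate H lam (2 * k) n) (estimate H lam (2 * k + 1) n) := by
  have hr := approx_ratio H hlam hq hdeg k
  have h1 := estimate_le_of_approx_le H hlam (fun U v => (hr U v).1) n
  have h2 := estimate_le_of_approx_le H hlam (fun U v => (hr U v).2) n
  have hp := fun t => (estimate_pos H hlam t n).le
  exact ⟨h1.trans (mul_le_mul_of_nonneg_right h (hp _)),
    h2.trans (mul_le_mul_of_nonneg_right h (hp _))⟩

theorem close_estimate_self (H : SimpleGraph ℕ) {lam eps : ℝ} (hlam : 0 < lam) (heps : 0 < eps)
    {t n : ℕ} (ht : n ≤ t) : Close eps (estimate H lam t n) (estimate H lam (t + 1) n) := by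
  have := estimate_pos H hlam t n
  rw [estimate_eq H hlam ht] at this
  rw [estimate_eq H hlam ht, estimate_eq H hlam (ht.trans t.le_succ), Close]
  constructor <;> nlinarith

/-- Since (q - 1) / (q + 1) ≤ exp(-2 / (q + 1)), its k-th power is at most X⁻⁴. With log q ≤ n, the
logarithm of the left side is at most 2 n² / X⁴ = 2 eps² / X² ≤ eps / 2 ≤ log (1 + eps). -/
theorem rpow_contraction_le {q X : ℝ} (hq : 1 < q) {n k : ℕ} (hn : 0 < n) {eps : ℝ} (heps : 0 < eps)
    (heps1 : eps < 1) (hX : X = n / eps) (hqn : q ≤ n) (hX2 : 2 ≤ X)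
    (hk : (q + 1) * (2 * Real.log X) ≤ k) :
    ((q ^ 2) ^ (((q - 1) / (q + 1)) ^ k)) ^ n ≤ 1 + eps := by
  have hX0 : 0 < X := by linarith
  have hn0 : (0 : ℝ) < n := by exact_mod_cast hn
  have hlq : Real.log q ≤ n := (Real.log_le_self (by linarith)).trans hqn
  have hlq0 : 0 ≤ Real.log q := Real.log_nonneg hq.le
  have hκ : (q - 1) / (q + 1) ≤ Real.exp (-(2 / (q + 1))) := by
    have := Real.add_one_le_exp (-(2 / (q + 1)))
    refine le_trans (le_of_eq ?_) this
    field_simp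
    ring
  have hκ0 : 0 ≤ (q - 1) / (q + 1) := div_nonneg (by linarith) (by linarith)
  have hκk : ((q - 1) / (q + 1)) ^ k ≤ (X ^ 4)⁻¹ := by
    calc ((q - 1) / (q + 1)) ^ k ≤ (Real.exp (-(2 / (q + 1)))) ^ k := by gcongr
      _ = Real.exp (-(2 / (q + 1) * k)) := by rw [← Real.exp_nat_mul]; ring_nf
      _ ≤ Real.exp (-(4 * Real.log X)) := by
          rw [Real.exp_le_exp, neg_le_neg_iff, div_mul_eq_mul_div, le_div_iff₀ (by linarith)]
          linarith
      _ = _ := by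
          rw [Real.exp_neg, mul_comm, Real.exp_mul, Real.exp_log hX0]
          norm_num
  have hne : (n : ℝ) = X * eps := by rw [hX]; field_simp
  have hmain : n * (((q - 1) / (q + 1)) ^ k * (2 * Real.log q)) ≤ eps / 2 := by
    calc n * (((q - 1) / (q + 1)) ^ k * (2 * Real.log q)) ≤ n * ((X ^ 4)⁻¹ * (2 * n)) := by gcongr
      _ = 2 * eps ^ 2 / X ^ 2 := by rw [hne]; field_simp
      _ ≤ eps / 2 := by
          rw [div_le_div_iff₀ (by positivity) (by norm_num)]
          nlinarith
  have hlog : eps / 2 ≤ Real.log (1 + eps) := by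
    have := Real.one_sub_inv_le_log_of_pos (show 0 < 1 + eps by linarith)
    refine le_trans ?_ this
    rw [← sub_nonneg]
    have : 1 - (1 + eps)⁻¹ - eps / 2 = eps * (1 - eps) / (2 * (1 + eps)) := by
      field_simp
      ring
    rw [this]
    exact div_nonneg (mul_nonneg heps.le (by linarith)) (by linarith)
  rw [← Real.log_le_log_iff (by positivity) (by linarith), Real.log_pow,
    Real.log_rpow (by positivity), Real.log_pow]
  push_cast
  linarith

/-- The depth at which the estimates become close. -/
theorem exists_close_estimate (H : SimpleGraph ℕ) {lam eps : ℝ} {n Δ : ℕ} (hlam : 0 < lam)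
    (heps : 0 < eps) (heps1 : eps < 1) (hn : 2 ≤ n) (hΔ : 2 ≤ Δ)
    (hdeg : ∀ U v, (nbrs H U v).card ≤ Δ) :
    ∃ l : ℕ, (l : ℝ) ≤ 20 * (max 1 (√(lam * Δ)) * Real.log (n / eps)) ∧
      Close eps (estimate H lam l n) (estimate H lam (l + 1) n) := by
  have hΔ' : (2 : ℝ) ≤ Δ := by exact_mod_cast hΔ
  have hn' : (2 : ℝ) ≤ n := by exact_mod_cast hn
  have hX2 : 2 ≤ n / eps := by
    rw [le_div_iff₀ heps]
    nlinarith
  have hL : 1 / 2 ≤ Real.log (n / eps) := by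
    have := Real.log_two_gt_d9
    have := Real.log_le_log (by norm_num) hX2
    linarith
  set M := max 1 (√(lam * Δ)) with hM
  have hM1 : 1 ≤ M := le_max_left _ _
  have hMD : lam * Δ ≤ M ^ 2 := by
    rw [← Real.sqrt_le_left (by linarith)]
    exact le_max_right _ _
  set q := √(1 + lam * Δ) with hq
  have hD : 0 < lam * Δ := by positivity
  have hq2 : q ^ 2 = 1 + lam * Δ := Real.sq_sqrt (by positivity)
  have hq0 : 0 ≤ q := Real.sqrt_nonneg _
  have hq1 : 1 < q := by nlinarith
  have hqM : q ≤ 3 / 2 * M := by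
    refine le_of_sq_le_sq ?_ (by positivity)
    nlinarith
  set L := Real.log (n / eps)
  have hML : 1 / 2 ≤ M * L := by nlinarith
  -- The contraction estimate uses q ≤ n. If q > n, depth n is exact, and n < q ≤ 3/2 * M is within
  -- the bound because L ≥ 1/2.
  by_cases hqn : q ≤ n
  · set k := ⌈(q + 1) * (2 * L)⌉₊ with hk
    have hk1 : (k : ℝ) < (q + 1) * (2 * L) + 1 := Nat.ceil_lt_add_one (by positivity)
    refine ⟨2 * k, ?_, close_estimate_of_le H hlam hq1 (fun U v => ?_) n k
      (rpow_contraction_le hq1 (by omega) heps heps1 rfl hqn hX2 (Nat.le_ceil _))⟩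
    · push_cast
      nlinarith
    · have : ((nbrs H U v).card : ℝ) ≤ Δ := by exact_mod_cast hdeg U v
      rw [hq2]
      nlinarith
  · exact ⟨n, by nlinarith, close_estimate_self H hlam heps le_rfl⟩

end MonomerDimer

namespace RealRAM

/-! ### Composition rules for runs of the machine -/

/-- With the programs `x` remaining to be executed, the machine gets from `s` within `b` steps to a
state that satisfies `Q` with the programs `y` remaining, whatever is to be executed afterwards. -/
def Reaches (x y : List Prog) (s : State) (b : ℕ) (Q : State → Prop) : Prop :=
  ∃ t ≤ b, ∃ s', (∀ k, step^[t] (x ++ k, s) = (y ++ k, s')) ∧ Q s'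

theorem Reaches.refl {x : List Prog} {s : State} {Q : State → Prop} (b : ℕ) (h : Q s) :
    Reaches x x s b Q :=
  ⟨0, Nat.zero_le _, s, fun _ => rfl, h⟩

theorem Reaches.trans {x y z : List Prog} {s : State} {b b' : ℕ} {Q R : State → Prop}
    (h : Reaches x y s b Q) (h' : ∀ s', Q s' → Reaches y z s' b' R) : Reaches x z s (b + b') R := by
  obtain ⟨t, ht, s₁, h₁, hQ⟩ := h
  obtain ⟨t', ht', s₂, h₂, hR⟩ := h' s₁ hQ
  refine ⟨t' + t, by omega, s₂, fun k => ?_, hR⟩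
  rw [Function.iterate_add_apply, h₁, h₂]

theorem Reaches.mono {x y : List Prog} {s : State} {b b' : ℕ} {Q R : State → Prop}
    (h : Reaches x y s b Q) (hb : b ≤ b') (hQ : ∀ s', Q s' → R s') : Reaches x y s b' R := by
  obtain ⟨t, ht, s₁, h₁, h₂⟩ := h
  exact ⟨t, ht.trans hb, s₁, h₁, hQ _ h₂⟩

theorem Reaches.append {x y : List Prog} {s : State} {b : ℕ} {Q : State → Prop}
    (h : Reaches x y s b Q) (z : List Prog) : Reaches (x ++ z) (y ++ z) s b Q := by
  obtain ⟨t, ht, s₁, h₁, h₂⟩ := h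
  exact ⟨t, ht, s₁, fun k => by rw [List.append_assoc, List.append_assoc, h₁], h₂⟩

theorem Reaches.of_step {x y : List Prog} {s s' : State}
    (h : ∀ k, step (x ++ k, s) = (y ++ k, s')) : Reaches x y s 1 (· = s') :=
  ⟨1, le_rfl, s', h, rfl⟩

theorem Reaches.step {x y z : List Prog} {s s' : State} {b : ℕ} {Q : State → Prop}
    (h : ∀ k, RealRAM.step (x ++ k, s) = (y ++ k, s')) (h' : Reaches y z s' b Q) :
    Reaches x z s (1 + b) Q :=
  (Reaches.of_step h).trans fun _ hs => hs ▸ h'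

/-- The program `p` halts within `b` steps from `s`, in a state that satisfies `Q`. -/
abbrev Runs (p : Prog) (s : State) (b : ℕ) (Q : State → Prop) : Prop := Reaches [p] [] s b Q

theorem Runs.seq {p q : Prog} {s : State} {b b' : ℕ} {Q R : State → Prop} (h : Runs p s b Q)
    (h' : ∀ s', Q s' → Runs q s' b' R) : Runs (.seq p q) s (1 + (b + b')) R :=
  .step (y := [p, q]) (fun _ => rfl) ((h.append [q]).trans h')

theorem Runs.ite_pos {c : Test} {p q : Prog} {s : State} {b : ℕ} {Q : State → Prop}
    (hc : c.Holds s) (h : Runs p s b Q) : Runs (.ite c p q) s (1 + b) Q :=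
  .step (y := [p]) (fun _ => if_pos hc) h

theorem Runs.ite_neg {c : Test} {p q : Prog} {s : State} {b : ℕ} {Q : State → Prop}
    (hc : ¬ c.Holds s) (h : Runs q s b Q) : Runs (.ite c p q) s (1 + b) Q :=
  .step (y := [q]) (fun _ => if_neg hc) h

theorem Runs.skip {s : State} {Q : State → Prop} (h : Q s) : Runs .skip s 1 Q :=
  .step (y := []) (fun _ => rfl) (.refl 0 h)

/-- The machine gets from the loop `while c p` in state `s` within `b` steps back to this loop, in a
state that satisfies `Q`. -/
abbrev Loops (c : Test) (p : Prog) (s : State) (b : ℕ) (Q : State → Prop) : Prop :=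
  Reaches [.while c p] [.while c p] s b Q

/-- Executions of a loop are cut into segments that begin and end at its test. They compose by
`Reaches.trans`, so an induction can follow nested visits inside one flat loop. -/
theorem Loops.once {c : Test} {p : Prog} {s : State} {b : ℕ} {Q : State → Prop}
    (hc : c.Holds s) (h : Runs p s b Q) : Loops c p s (1 + b) Q :=
  .step (y := [p, .while c p]) (fun _ => if_pos hc) (h.append [.while c p])

theorem Loops.exit {c : Test} {p : Prog} {s : State} {b : ℕ} {Q : State → Prop}
    (h : Loops c p s b Q) (hc : ∀ s', Q s' → ¬ c.Holds s') : Runs (.while c p) s (b + 1) Q :=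
  h.trans fun s' hs => .step (b := 0) (y := []) (fun _ => if_neg (hc s' hs)) (.refl 0 hs)

theorem HaltsWithin.of_runs {p : Prog} {s : State} {b : ℕ} {Q : State → Prop} (h : Runs p s b Q) :
    ∃ t ≤ b, ∃ s', HaltsWithin p s t s' ∧ Q s' := by
  obtain ⟨t, ht, s', h, hQ⟩ := h
  exact ⟨t, ht, s', h [], hQ⟩

/-- Straight-line code. -/
def block : List Instr → Prog
  | [] => .skip
  | i :: l => .seq (.instr i) (block l)

theorem Runs.block {l : List Instr} {s : State} {Q : State → Prop} (h : Q (l.foldl Instr.exec s)) :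
    Runs (block l) s (2 * l.length + 1) Q := by
  induction l generalizing s with
  | nil => exact .skip h
  | cons i l ih =>
    refine (Runs.seq (b := 1) (b' := 2 * l.length + 1) (Q := (· = i.exec s))
      (.of_step fun _ => rfl) ?_).mono (le_of_eq ?_) fun _ h => h
    · rintro s' rfl
      exact ih h
    · simp only [List.length_cons]
      omega

/-! The algorithm. Natural registers: `0` holds `n`, `1` holds `0`, `2` holds `1`, `3` holds `n * n`,
`4` holds the maximal number of vertices of a path, `5` the current root, `6` the number of vertices
of the current path, `7` the next vertex to be tried, `8` holds `1` until the algorithm is about to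
halt. Real registers: `0` holds `lam`, `1` holds `eps`, `2` holds `1`, `3` and `4` hold the last two
estimates, `5` the current partial product. The memory cell `n * n + 2 * i` tells whether `i` is on
the current path, the memory cell `n * n + 2 * i + 1` holds the `i`-th vertex of the current path,
whose sum over children accumulates in the real memory cell `i`. -/

/-- Adds the product of the registers `0` and `10` to the register `11`. -/
def mulLoop : Prog := .while (.lt 1 10) (block [.add 11 11 0, .sub 10 10 2])

/-- Appends the vertex in register `7` to the path. -/
def push : Prog := block [.add 6 6 2, .add 11 6 6, .add 11 11 3, .add 11 11 2, .store 11 7,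
  .add 11 7 7, .add 11 11 3, .store 11 2, .rconst 6 0, .rstore 6 6, .const 7 0]

/-- Removes the last vertex from the path and adds its value to the sum of its parent. -/
def pop : Prog := block [.add 11 6 6, .add 11 11 3, .add 11 11 2, .load 9 11,
  .add 11 9 9, .add 11 11 3, .store 11 1, .rload 6 6, .rmul 6 0 6, .radd 6 2 6, .rdiv 6 2 6,
  .sub 6 6 2, .rload 7 6, .radd 7 7 6, .rstore 6 7, .add 7 9 2]

/-- One step of the depth first search. -/
def searchStep : Prog := .ite (.lt 7 5)
  (.seq (block [.add 11 6 6, .add 11 11 3, .add 11 11 2, .load 9 11, .add 10 9 1, .add 11 7 1])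
    (.seq mulLoop
      (.seq (block [.load 12 11, .add 11 7 7, .add 11 11 3, .load 13 11])
        (.ite (.lt 13 12) (.ite (.lt 6 4) push (block [.add 7 7 2])) (block [.add 7 7 2])))))
  pop

/-- Divides the partial product by the value of the current root. -/
def rootStep : Prog :=
  .seq (block [.add 7 5 1, .rconst 6 0, .rstore 6 6])
    (.seq push (.seq (.while (.lt 1 6) searchStep)
      (block [.rload 6 6, .rdiv 5 5 6, .add 5 5 2])))

/-- Computes the next estimate and compares it with the last one. -/
def estimateStep : Prog :=
  .seq (block [.rmul 3 4 2, .add 4 4 2, .rconst 5 1, .const 5 0])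
    (.seq (.while (.lt 5 0) rootStep)
      (.seq (block [.rmul 4 5 2, .radd 6 2 1, .rmul 7 6 3, .rmul 8 6 4])
        (.ite (.rle 4 7) (.ite (.rle 3 8) (block [.const 8 0]) .skip) .skip)))

/-- The algorithm. -/
def algorithm : Prog :=
  .seq (block [.const 2 1, .const 8 1, .const 4 1, .rconst 2 1, .rconst 4 1, .add 10 0 1])
    (.seq mulLoop
      (.seq (block [.add 3 11 1])
        (.seq (.while (.lt 1 8) estimateStep) (block [.rmul 0 4 2]))))

/-! ### Effect of the elementary parts of the program -/

/-- The state `s` with new values for the registers `10` and `11`. -/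
def State.setMul (s : State) (c a : ℕ) : State :=
  { s with reg := Function.update (Function.update s.reg 10 c) 11 a }

/-- The machine cannot multiply natural numbers, so addresses in the adjacency matrix are found by
repeated addition, counting register 10 down. -/
theorem mulLoop_runs {s : State} (h1 : s.reg 1 = 0) (h2 : s.reg 2 = 1) :
    Runs mulLoop s (6 * s.reg 10 + 1) (· = s.setMul 0 (s.reg 11 + s.reg 10 * s.reg 0)) := by
  refine Loops.exit (Q := (· = s.setMul 0 (s.reg 11 + s.reg 10 * s.reg 0))) ?_ ?_
  · generalize hc : s.reg 10 = c
    induction c generalizing s with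
    | zero =>
      refine .refl _ ?_
      rw [State.setMul, ← hc, Function.update_eq_self, hc, zero_mul, add_zero,
        Function.update_eq_self]
    | succ c ih =>
      refine ((Loops.once ?_ (.block (Q := (· = s.setMul c (s.reg 11 + s.reg 0)))
        ?_)).trans (b' := 6 * c) ?_).mono ?_ fun _ h => h
      · simp [Test.Holds, h1, hc]
      · simp only [List.foldl, Instr.exec, State.setMul]
        congr 1
        ext x
        simp [Function.update_apply, h2, hc]
        grind
      · rintro s' rfl
        refine (ih ?_ ?_ ?_).mono le_rfl ?_
        · simpa [State.setMul] using h1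
        · simpa [State.setMul] using h2
        · simp [State.setMul]
        rintro s' rfl
        simp only [State.setMul]
        congr 1
        ext x
        simp [Function.update_apply]
        grind
      · simp only [List.length_cons, List.length_nil]
        omega
  · rintro s' rfl
    simp [Test.Holds, State.setMul, h1]

/-- The quantities that stay constant during a depth first search. -/
structure Env where
  H : SimpleGraph ℕ
  n : ℕ
  lam : ℝ
  eps : ℝ
  L : ℕ
  m : ℕ
  go : ℕ
  prev : ℝ
  cur : ℝ
  Z : ℝ

open Classical in
/-- The state `s` represents a depth first search with `D` vertices on the path, the next vertex to
be tried `u`, the set `S` of vertices on the path, the path `vert` and the sums `acc`. -/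
structure Rep (e : Env) (D u : ℕ) (S : Finset ℕ) (vert : ℕ → ℕ) (acc : ℕ → ℝ) (s : State) :
    Prop where
  reg0 : s.reg 0 = e.n
  reg1 : s.reg 1 = 0
  reg2 : s.reg 2 = 1
  reg3 : s.reg 3 = e.n * e.n
  reg4 : s.reg 4 = e.L
  reg5 : s.reg 5 = e.m
  reg6 : s.reg 6 = D
  reg7 : s.reg 7 = u
  reg8 : s.reg 8 = e.go
  rreg0 : s.rreg 0 = e.lam
  rreg1 : s.rreg 1 = e.eps
  rreg2 : s.rreg 2 = 1
  rreg3 : s.rreg 3 = e.prev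
  rreg4 : s.rreg 4 = e.cur
  rreg5 : s.rreg 5 = e.Z
  adj : ∀ v < e.n, ∀ u < e.n, s.mem (u + v * e.n) = if e.H.Adj v u then 1 else 0
  flag : ∀ i, s.mem (e.n * e.n + 2 * i) = if i ∈ S then 1 else 0
  vert : ∀ i ≤ D, s.mem (e.n * e.n + 2 * i + 1) = vert i
  acc : ∀ i ≤ D, s.rmem i = acc i

theorem add_mul_lt {u v n : ℕ} (hu : u < n) (hv : v < n) : u + v * n < n * n := by
  nlinarith

theorem push_runs {e : Env} {D u : ℕ} {S : Finset ℕ} {vert : ℕ → ℕ} {acc : ℕ → ℝ} {s : State}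
    (h : Rep e D u S vert acc s) : Runs push s 23 (Rep e (D + 1) 0 (insert u S)
      (Function.update vert (D + 1) u) (Function.update acc (D + 1) 0)) := by
  refine .block ?_
  obtain ⟨h0, h1, h2, h3, h4, h5, h6, h7, h8, r0, r1, r2, r3, r4, r5, ha, hf, hv, hc⟩ := h
  refine ⟨?_, ?_, ?_, ?_, ?_, ?_, ?_, ?_, ?_, ?_, ?_, ?_, ?_, ?_, ?_, ?_, ?_, ?_, ?_⟩
  all_goals try simp [Instr.exec, Function.update_apply, *]
  · intro v hv u hu
    have := add_mul_lt hu hv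
    rw [if_neg (by omega), if_neg (by omega), ha v hv u hu]
  · intro i
    grind
  · intro i hi
    have := hv i
    grind
  · intro i hi
    have := hc i
    grind

/-- The next candidate is the successor of the popped vertex, so the scan of its parent resumes
where it was interrupted. Position 0 lies below the root: its sum receives the value of the root. -/
theorem pop_runs {e : Env} {D u : ℕ} {S : Finset ℕ} {vert : ℕ → ℕ} {acc : ℕ → ℝ} {s : State}
    (h : Rep e (D + 1) u S vert acc s) :
    Runs pop s 33 (Rep e D (vert (D + 1) + 1) (S.erase (vert (D + 1))) vert
      (Function.update acc D (acc D + 1 / (1 + e.lam * acc (D + 1))))) := by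
  refine .block ?_
  obtain ⟨h0, h1, h2, h3, h4, h5, h6, h7, h8, r0, r1, r2, r3, r4, r5, ha, hf, hv, hc⟩ := h
  have hv1 := hv (D + 1) le_rfl
  rw [show e.n * e.n + 2 * (D + 1) + 1 = D + 1 + (D + 1) + e.n * e.n + 1 by ring] at hv1
  have hc1 := hc (D + 1) le_rfl
  have hc0 := hc D (by omega)
  refine ⟨?_, ?_, ?_, ?_, ?_, ?_, ?_, ?_, ?_, ?_, ?_, ?_, ?_, ?_, ?_, ?_, ?_, ?_, ?_⟩
  all_goals try simp [Instr.exec, Function.update_apply, *]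
  · intro v hv u hu
    have := add_mul_lt hu hv
    rw [if_neg (by omega), ha v hv u hu]
  · intro i
    grind
  · intro i hi
    have := hv i
    grind
  · intro i hi
    have := hc i
    grind

/-- The flag and the matrix entry are 0 or 1, so flag < entry tests adjacency and absence from the
path at once. Leaving q and Q open lets the skipping and pushing cases share this computation. -/
theorem compare_runs {e : Env} {D u : ℕ} {S : Finset ℕ} {vert : ℕ → ℕ} {acc : ℕ → ℝ} {s : State}
    (h : Rep e D u S vert acc s) (hu : u < e.n) (hD : vert D < e.n) {q : Prog} {b : ℕ}
    {Q : State → Prop} (hq : ∀ s', Rep e D u S vert acc s' →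
      (s'.reg 13 < s'.reg 12 ↔ e.H.Adj (vert D) u ∧ u ∉ S) → Runs q s' b Q) :
    Runs (.seq (block [.add 11 6 6, .add 11 11 3, .add 11 11 2, .load 9 11, .add 10 9 1, .add 11 7 1])
      (.seq mulLoop
        (.seq (block [.load 12 11, .add 11 7 7, .add 11 11 3, .load 13 11]) q))) s
      (6 * e.n + 26 + b) Q := by
  have hD' := h.vert D le_rfl
  rw [show e.n * e.n + 2 * D + 1 = D + D + e.n * e.n + 1 by ring] at hD'
  refine (Runs.seq (b' := 1 + ((6 * e.n + 1) + (1 + (9 + b)))) (.block (Q := fun s' =>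
    Rep e D u S vert acc s' ∧ s'.reg 10 = vert D ∧ s'.reg 11 = u) ?_) ?_).mono ?_ fun _ h => h
  · obtain ⟨h0, h1, h2, h3, h4, h5, h6, h7, h8, r0, r1, r2, r3, r4, r5, ha, hf, hv, hc⟩ := h
    refine ⟨⟨?_, ?_, ?_, ?_, ?_, ?_, ?_, ?_, ?_, ?_, ?_, ?_, ?_, ?_, ?_, ha, hf, hv, hc⟩, ?_, ?_⟩
    all_goals simp [Instr.exec, *]
  · rintro s₁ ⟨h, h10, h11⟩
    refine Runs.seq ((mulLoop_runs h.reg1 h.reg2).mono ?_ fun _ h => h) ?_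
    · rw [h10]
      omega
    rintro s₂ rfl
    refine Runs.seq (.block (Q := fun s' => Rep e D u S vert acc s' ∧
      (s'.reg 13 < s'.reg 12 ↔ e.H.Adj (vert D) u ∧ u ∉ S)) ?_) fun s₃ h₃ => hq s₃ h₃.1 h₃.2
    have hau := h.adj _ hD u hu
    have hfu := h.flag u
    rw [show e.n * e.n + 2 * u = u + u + e.n * e.n by ring] at hfu
    obtain ⟨h0, h1, h2, h3, h4, h5, h6, h7, h8, r0, r1, r2, r3, r4, r5, ha, hf, hv, hc⟩ := h
    refine ⟨⟨?_, ?_, ?_, ?_, ?_, ?_, ?_, ?_, ?_, ?_, ?_, ?_, ?_, ?_, ?_, ha, hf, hv, hc⟩, ?_⟩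
    all_goals simp [Instr.exec, State.setMul, *]
    grind
  · simp only [List.length_cons, List.length_nil]
    omega

theorem skip_runs {e : Env} {D u : ℕ} {S : Finset ℕ} {vert : ℕ → ℕ} {acc : ℕ → ℝ} {s : State}
    (h : Rep e D u S vert acc s) : Runs (block [.add 7 7 2]) s 3 (Rep e D (u + 1) S vert acc) := by
  refine .block ?_
  obtain ⟨h0, h1, h2, h3, h4, h5, h6, h7, h8, r0, r1, r2, r3, r4, r5, ha, hf, hv, hc⟩ := h
  refine ⟨?_, ?_, ?_, ?_, ?_, ?_, ?_, ?_, ?_, ?_, ?_, ?_, ?_, ?_, ?_, ha, hf, hv, hc⟩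
  all_goals simp [Instr.exec, *]

theorem searchStep_skip {e : Env} {D u : ℕ} {S : Finset ℕ} {vert : ℕ → ℕ} {acc : ℕ → ℝ} {s : State}
    (h : Rep e D u S vert acc s) (hm : e.m ≤ e.n) (hu : u < e.m) (hD : vert D < e.n)
    (hn : ¬ (D < e.L ∧ e.H.Adj (vert D) u ∧ u ∉ S)) :
    Runs searchStep s (6 * e.n + 60) (Rep e D (u + 1) S vert acc) := by
  refine (Runs.ite_pos (by simpa [Test.Holds, h.reg7, h.reg5] using hu) (compare_runs h
    (by omega) hD (b := 6) fun s' h' hs' => ?_)).mono (by omega) fun _ h => h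
  by_cases hc : s'.reg 13 < s'.reg 12
  · refine (Runs.ite_pos (c := .lt 13 12) hc (Runs.ite_neg ?_ (skip_runs h'))).mono (by omega)
      fun _ h => h
    rw [hs'] at hc
    simpa [Test.Holds, h'.reg6, h'.reg4] using fun h => hn ⟨h, hc⟩
  · exact (Runs.ite_neg (c := .lt 13 12) hc (skip_runs h')).mono (by omega) fun _ h => h

theorem searchStep_push {e : Env} {D u : ℕ} {S : Finset ℕ} {vert : ℕ → ℕ} {acc : ℕ → ℝ} {s : State}
    (h : Rep e D u S vert acc s) (hm : e.m ≤ e.n) (hu : u < e.m) (hD : vert D < e.n)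
    (hn : D < e.L ∧ e.H.Adj (vert D) u ∧ u ∉ S) :
    Runs searchStep s (6 * e.n + 60) (Rep e (D + 1) 0 (insert u S)
      (Function.update vert (D + 1) u) (Function.update acc (D + 1) 0)) := by
  refine (Runs.ite_pos (by simpa [Test.Holds, h.reg7, h.reg5] using hu) (compare_runs h
    (by omega) hD (b := 25) fun s' h' hs' => ?_)).mono (by omega) fun _ h => h
  refine Runs.ite_pos (c := .lt 13 12) (hs'.2 hn.2) (Runs.ite_pos ?_ (push_runs h'))
  simpa [Test.Holds, h'.reg6, h'.reg4] using hn.1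

theorem searchStep_pop {e : Env} {D u : ℕ} {S : Finset ℕ} {vert : ℕ → ℕ} {acc : ℕ → ℝ} {s : State}
    (h : Rep e (D + 1) u S vert acc s) (hu : e.m ≤ u) :
    Runs searchStep s (6 * e.n + 60) (Rep e D (vert (D + 1) + 1) (S.erase (vert (D + 1))) vert
      (Function.update acc D (acc D + 1 / (1 + e.lam * acc (D + 1))))) :=
  (Runs.ite_neg (by simpa [Test.Holds, h.reg7, h.reg5] using hu) (pop_runs h)).mono (by omega)
    fun _ h => h

open MonomerDimer

/-! ### The depth first search evaluates the truncated recursion -/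

theorem Rep.congr {e : Env} {D u : ℕ} {S : Finset ℕ} {vert vert' : ℕ → ℕ} {acc acc' : ℕ → ℝ}
    {s : State} (h : Rep e D u S vert acc s) (hv : ∀ i ≤ D, vert i = vert' i)
    (ha : ∀ i ≤ D, acc i = acc' i) : Rep e D u S vert' acc' s :=
  { h with
    vert := fun i hi => (h.vert i hi).trans (hv i hi)
    acc := fun i hi => (h.acc i hi).trans (ha i hi) }

theorem Rep.holds_lt {e : Env} {D u : ℕ} {S : Finset ℕ} {vert : ℕ → ℕ} {acc : ℕ → ℝ} {s : State}
    (h : Rep e D u S vert acc s) : Test.Holds s (.lt 1 6) ↔ 0 < D := by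
  simp [Test.Holds, h.reg1, h.reg6]

/-- The remaining scan over the candidates `u, …, m - 1` for the next vertex of the path. -/
theorem scan_loops {e : Env} (hm : e.m ≤ e.n) {N S : Finset ℕ} {F : ℕ → ℝ} {c D v : ℕ}
    (hv : v < e.n) (hN : ∀ w, w ∈ N ↔ w < e.m ∧ D + 1 < e.L ∧ e.H.Adj v w ∧ w ∉ S)
    (hchild : ∀ w ∈ N, ∀ vert acc s, Rep e (D + 2) 0 (insert w S) vert acc s →
      vert (D + 2) = w → acc (D + 2) = 0 → Loops (.lt 1 6) searchStep s c
        (Rep e (D + 1) (w + 1) S vert (Function.update acc (D + 1) (acc (D + 1) + F w))))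
    {j u : ℕ} {vert : ℕ → ℕ} {acc : ℕ → ℝ} {s : State} (hj : u + j = e.m) (hvert : vert (D + 1) = v)
    (h : Rep e (D + 1) u S vert acc s) :
    Loops (.lt 1 6) searchStep s ((6 * e.n + 61) * j + (N.filter (u ≤ ·)).card * c)
      (Rep e (D + 1) e.m S vert (Function.update acc (D + 1)
        (acc (D + 1) + ∑ w ∈ N.filter (u ≤ ·), F w))) := by
  induction j generalizing u acc s with
  | zero =>
    have : N.filter (u ≤ ·) = ∅ := by
      refine Finset.filter_eq_empty_iff.2 fun w hw => ?_
      have := (hN w).1 hw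
      omega
    rw [this]
    refine .refl _ ?_
    rw [add_zero] at hj
    simpa [← hj] using h
  | succ j ih =>
    have hu : u < e.m := by omega
    have hpos := h.holds_lt.2 D.succ_pos
    -- A child costs one iteration for its push and at most c steps for its visit, which ends with u
    -- + 1 as the next candidate; any other u costs one iteration.
    by_cases hc : u ∈ N
    · have hf : N.filter (u ≤ ·) = insert u (N.filter (u + 1 ≤ ·)) := by
        ext w
        simp only [Finset.mem_filter, Finset.mem_insert]
        grind
      have hnm : u ∉ N.filter (u + 1 ≤ ·) := by simp
      rw [hf, Finset.card_insert_of_notMem hnm, Finset.sum_insert hnm]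
      have hp := (hN u).1 hc
      refine Reaches.mono ((Loops.once hpos (searchStep_push h hm hu (hvert ▸ hv)
        ⟨hp.2.1, hvert ▸ hp.2.2.1, hp.2.2.2⟩)).trans fun s₁ h₁ => (hchild u hc _ _ _ h₁ (by simp)
        (by simp)).trans fun s₂ h₂ => ih (by omega)
          (h₂.congr (vert' := vert) (acc' := Function.update acc (D + 1) (acc (D + 1) + F u))
            (fun i hi => ?_) fun i hi => ?_)) ?_ fun s₃ h₃ => ?_
      · rw [Function.update_of_ne (by omega)]
      · simp only [Function.update_apply]
        grind
      · ring_nf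
        omega
      · simpa [add_assoc] using h₃
    · have hf : N.filter (u ≤ ·) = N.filter (u + 1 ≤ ·) := by
        refine Finset.filter_congr fun w hw => ?_
        have : w ≠ u := by
          rintro rfl
          exact hc hw
        omega
      rw [hf]
      refine Reaches.mono ((Loops.once hpos (searchStep_skip h hm hu (hvert ▸ hv) fun hn => hc
        ((hN u).2 ⟨hu, hn.1, hvert ▸ hn.2.1, hn.2.2⟩))).trans fun s₁ h₁ => ih (by omega) h₁) ?_
        fun s₃ h₃ => h₃
      ring_nf
      omega

theorem finish_loops {e : Env} {D : ℕ} {S : Finset ℕ} {vert : ℕ → ℕ} {acc : ℕ → ℝ} {x : ℝ}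
    {s : State} (hacc : acc (D + 1) = 0)
    (h : Rep e (D + 1) e.m S vert (Function.update acc (D + 1) (acc (D + 1) + x)) s) :
    Loops (.lt 1 6) searchStep s (6 * e.n + 61)
      (Rep e D (vert (D + 1) + 1) (S.erase (vert (D + 1))) vert (Function.update acc D
        (acc D + 1 / (1 + e.lam * x)))) := by
  refine (Loops.once (h.holds_lt.2 D.succ_pos) (searchStep_pop h le_rfl)).mono (by omega)
    fun s' h' => h'.congr (fun _ _ => rfl) fun i hi => ?_
  simp only [Function.update_apply, hacc]
  grind

/-- A bound for the number of steps of a depth first search of depth `t`. -/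
def searchBound (n Δ : ℕ) : ℕ → ℕ
  | 0 => n + 1
  | t + 1 => n + 1 + Δ * searchBound n Δ t

/-- The depth first search computes the truncated recursion. -/
theorem visit_loops {e : Env} {Δ : ℕ} (hm : e.m ≤ e.n) (hdeg : ∀ U v, (nbrs e.H U v).card ≤ Δ)
    {t D : ℕ} {S : Finset ℕ} {vert : ℕ → ℕ} {acc : ℕ → ℝ} {s : State} (ht : D + 1 + t = e.L)
    (hv : vert (D + 1) < e.n) (hacc : acc (D + 1) = 0) (h : Rep e (D + 1) 0 S vert acc s) :
    Loops (.lt 1 6) searchStep s ((6 * e.n + 61) * searchBound e.n Δ t)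
      (Rep e D (vert (D + 1) + 1) (S.erase (vert (D + 1))) vert (Function.update acc D
        (acc D + approx e.H e.lam t (Finset.range e.m \ S) (vert (D + 1))))) := by
  induction t generalizing D S vert acc s with
  | zero =>
    -- At the depth limit the candidates are still scanned but none is pushed; the sum stays 0 and
    -- the value is 1 / (1 + 0), the cut-off value of `approx`.
    refine ((scan_loops hm (N := ∅) (F := fun _ => 0) (c := 0) hv (fun w => ?_) (by simp)
      (zero_add e.m) rfl h).trans fun s' h' => finish_loops hacc h').mono ?_ fun s' h' => ?_
    · simp only [Finset.notMem_empty, false_iff]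
      omega
    · simp only [searchBound, Finset.filter_empty, Finset.card_empty, zero_mul, add_zero]
      nlinarith
    · simpa [approx] using h'
  | succ t ih =>
    refine ((scan_loops hm (N := nbrs e.H (Finset.range e.m \ S) (vert (D + 1)))
      (F := fun w => approx e.H e.lam t ((Finset.range e.m \ S).erase w) w)
      (c := (6 * e.n + 61) * searchBound e.n Δ t) hv (fun w => ?_) (fun w hw vert' acc' s' h' hw' ha' => ?_)
      (zero_add e.m) rfl h).trans fun s' h' => finish_loops hacc h').mono ?_ fun s' h' => ?_
    · simp only [mem_nbrs, Finset.mem_sdiff, Finset.mem_range]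
      have : D + 1 < e.L := by omega
      tauto
    · have hw1 := (mem_nbrs.1 hw).1
      rw [Finset.mem_sdiff, Finset.mem_range] at hw1
      have hw' : vert' (D + 1 + 1) = w := hw'
      have := ih (D := D + 1) (by omega) (by omega) ha' h'
      -- The visit of w unmarks w again, and inserting w into the path is erasing it from the set of
      -- free vertices, as in the recursion.
      rwa [hw', Finset.erase_insert hw1.2, Finset.sdiff_insert] at this
    · have := hdeg (Finset.range e.m \ S) (vert (D + 1))
      simp only [searchBound, zero_le, Finset.filter_true]
      calc _ ≤ (6 * e.n + 61) * e.n + Δ * ((6 * e.n + 61) * searchBound e.n Δ t) + (6 * e.n + 61) := by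
            gcongr
        _ ≤ _ := le_of_eq (by ring)
    · simpa [approx] using h'

/-! ### From roots to estimates to the main loop -/

/-- No depth first search is going on. -/
def Idle (e : Env) (s : State) : Prop := ∃ u vert acc, Rep e 0 u ∅ vert acc s

theorem succ_le_searchBound (n Δ t : ℕ) : n + 1 ≤ searchBound n Δ t := by
  cases t <;> simp [searchBound]

theorem searchBound_mono (n Δ : ℕ) : Monotone (searchBound n Δ) := by
  refine monotone_nat_of_le_succ fun t => ?_
  induction t with
  | zero => simp [searchBound]
  | succ t ih =>
    rw [searchBound, searchBound]
    gcongr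

theorem rootStep_runs {e : Env} {Δ t : ℕ} {s : State} (hdeg : ∀ U v, (nbrs e.H U v).card ≤ Δ)
    (ht : e.L = t + 1) (hm : e.m < e.n) (h : Idle e s) :
    Runs rootStep s ((6 * e.n + 61) * searchBound e.n Δ t + 41) (Idle { e with
      m := e.m + 1, Z := e.Z / approx e.H e.lam t (Finset.range e.m) e.m }) := by
  obtain ⟨u, vert, acc, h⟩ := h
  refine (Runs.seq (b' := 33 + (6 * e.n + 61) * searchBound e.n Δ t) (.block
    (Q := Rep e 0 e.m ∅ vert fun _ => 0) ?_) fun s₁ h₁ => (Runs.seq (push_runs h₁) fun s₂ h₂ =>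
      Runs.seq ((visit_loops (t := t) hm.le hdeg ?_ ?_ ?_ h₂).exit fun s₃ h₃ => ?_)
        fun s₃ h₃ => Runs.block ?_).mono ?_ fun _ h => h).mono ?_ fun _ h => h
  · obtain ⟨h0, h1, h2, h3, h4, h5, h6, h7, h8, r0, r1, r2, r3, r4, r5, ha, hf, hv, hc⟩ := h
    refine ⟨?_, ?_, ?_, ?_, ?_, ?_, ?_, ?_, ?_, ?_, ?_, ?_, ?_, ?_, ?_, ha, hf, hv, ?_⟩
    all_goals simp [Instr.exec, *]
  · omega
  · simpa using hm
  · simp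
  · rw [h₃.holds_lt]
    simp
  · have hr := h₃.acc 0 le_rfl
    have hs : Finset.range e.m \ {e.m} = Finset.range e.m :=
      Finset.sdiff_eq_self_of_disjoint (by simp)
    simp [hs] at hr
    refine ⟨_, _, _, Rep.mk (u := s₃.reg 7) ?_ ?_ ?_ ?_ ?_ ?_ ?_ ?_ ?_ ?_ ?_ ?_ ?_ ?_ ?_ h₃.adj ?_
      h₃.vert h₃.acc⟩
    pick_goal 16
    · simpa [Instr.exec] using h₃.flag
    all_goals simp [Instr.exec, h₃.reg0, h₃.reg1, h₃.reg2, h₃.reg3, h₃.reg4, h₃.reg5, h₃.reg6,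
      h₃.reg8, h₃.rreg0, h₃.rreg1, h₃.rreg2, h₃.rreg3, h₃.rreg4, h₃.rreg5, hr]
  · simp only [List.length_cons, List.length_nil]
    omega
  · simp only [List.length_cons, List.length_nil]
    omega

theorem roots_loops {e : Env} {Δ t : ℕ} {s : State} (hdeg : ∀ U v, (nbrs e.H U v).card ≤ Δ)
    (ht : e.L = t + 1) {j : ℕ} (hj : e.m + j = e.n) (hZ : e.Z = estimate e.H e.lam t e.m)
    (h : Idle e s) : Loops (.lt 5 0) rootStep s ((6 * e.n + 103) * searchBound e.n Δ t * j)
      (Idle { e with m := e.n, Z := estimate e.H e.lam t e.n }) := by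
  induction j generalizing e s with
  | zero =>
    refine .refl _ ?_
    cases e
    rw [add_zero] at hj
    simp only at hj hZ
    subst hj hZ
    exact h
  | succ j ih =>
    have hm : e.m < e.n := by omega
    refine ((Loops.once ?_ (rootStep_runs hdeg ht hm h)).trans fun s₁ h₁ =>
      ih (e := { e with m := e.m + 1, Z := _ }) hdeg ht (show e.m + 1 + j = e.n by omega) ?_ h₁).mono ?_
        fun s₂ h₂ => h₂
    · obtain ⟨u, vert, acc, h⟩ := h
      simpa [Test.Holds, h.reg5, h.reg0] using hm
    · rw [hZ, estimate, estimate, Finset.prod_range_succ, mul_one_div]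
    -- The 42 steps of overhead per root are absorbed into 103 = 61 + 42, since `searchBound` is at
    -- least 1.
    · have := succ_le_searchBound e.n Δ t
      nlinarith

/-- Before and after a round of the main loop: the last estimate is the one of depth `t`. -/
def Ready (H : SimpleGraph ℕ) (n : ℕ) (lam eps : ℝ) (t go : ℕ) (s : State) : Prop :=
  ∃ m prev Z, Idle ⟨H, n, lam, eps, t + 1, m, go, prev, estimate H lam t n, Z⟩ s

theorem estimateStep_runs {H : SimpleGraph ℕ} {n Δ : ℕ} {lam eps : ℝ} {t : ℕ} {s : State}
    (hdeg : ∀ U v, (nbrs H U v).card ≤ Δ) (h : Ready H n lam eps t 1 s) :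
    Runs estimateStep s ((6 * n + 103) * searchBound n Δ (t + 1) * n + 30) fun s' =>
      Close eps (estimate H lam t n) (estimate H lam (t + 1) n) ∧ Ready H n lam eps (t + 1) 0 s' ∨
      ¬ Close eps (estimate H lam t n) (estimate H lam (t + 1) n) ∧
        Ready H n lam eps (t + 1) 1 s' := by
  obtain ⟨m, prev, Z, u, vert, acc, h⟩ := h
  refine (Runs.seq (b' := 20 + (6 * n + 103) * searchBound n Δ (t + 1) * n) (.block
    (Q := Idle ⟨H, n, lam, eps, t + 2, 0, 1, estimate H lam t n, estimate H lam t n, 1⟩) ?_)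
    fun s₁ h₁ => (Runs.seq ((roots_loops (t := t + 1) hdeg rfl (zero_add n) ?_ h₁).exit
      fun s₂ h₂ => ?_) fun s₂ h₂ => Runs.seq (b' := 5) (.block (Q := fun s => Idle ⟨H, n, lam, eps, t + 2, n, 1,
        estimate H lam t n, estimate H lam (t + 1) n, estimate H lam (t + 1) n⟩ s ∧
        s.rreg 7 = (1 + eps) * estimate H lam t n ∧
        s.rreg 8 = (1 + eps) * estimate H lam (t + 1) n) ?_) fun s₃ h₃ => ?_).mono ?_
      fun _ h => h).mono ?_ fun _ h => h
  · obtain ⟨h0, h1, h2, h3, h4, h5, h6, h7, h8, r0, r1, r2, r3, r4, r5, ha, hf, hv, hc⟩ := h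
    refine ⟨_, _, _, Rep.mk (u := u) ?_ ?_ ?_ ?_ ?_ ?_ ?_ ?_ ?_ ?_ ?_ ?_ ?_ ?_ ?_ ha hf hv hc⟩
    all_goals simp [Instr.exec, *]
  · simp [estimate]
  · obtain ⟨u, vert, acc, h₂⟩ := h₂
    simp [Test.Holds, h₂.reg0, h₂.reg5]
  · obtain ⟨u, vert, acc, h₂⟩ := h₂
    obtain ⟨h0, h1, h2, h3, h4, h5, h6, h7, h8, r0, r1, r2, r3, r4, r5, ha, hf, hv, hc⟩ := h₂
    refine ⟨⟨_, _, _, Rep.mk (u := u) ?_ ?_ ?_ ?_ ?_ ?_ ?_ ?_ ?_ ?_ ?_ ?_ ?_ ?_ ?_ ha hf hv hc⟩,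
      ?_, ?_⟩
    all_goals simp [Instr.exec, *]
  · obtain ⟨⟨u, vert, acc, h⟩, h7, h8⟩ := h₃
    by_cases hc₁ : estimate H lam (t + 1) n ≤ (1 + eps) * estimate H lam t n
    · refine Runs.ite_pos (b := 4) (by simpa [Test.Holds, h.rreg4, h7] using hc₁) ?_
      by_cases hc₂ : estimate H lam t n ≤ (1 + eps) * estimate H lam (t + 1) n
      · refine Runs.ite_pos (b := 3) (by simpa [Test.Holds, h.rreg3, h8] using hc₂)
          (.block (.inl ⟨⟨hc₁, hc₂⟩, n, estimate H lam t n, estimate H lam (t + 1) n, ?_⟩))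
        obtain ⟨h0, h1, h2, h3, h4, h5, h6, h7, h8, r0, r1, r2, r3, r4, r5, ha, hf, hv, hc⟩ := h
        refine ⟨_, _, _, Rep.mk (u := u) ?_ ?_ ?_ ?_ ?_ ?_ ?_ ?_ ?_ ?_ ?_ ?_ ?_ ?_ ?_ ha hf hv hc⟩
        all_goals simp [Instr.exec, *]
      · exact (Runs.ite_neg (by simpa [Test.Holds, h.rreg3, h8] using hc₂)
          (.skip (.inr ⟨fun h => hc₂ h.2, _, _, _, _, _, _, h⟩))).mono (by omega) fun _ h => h
    · exact (Runs.ite_neg (by simpa [Test.Holds, h.rreg4, h7] using hc₁)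
        (.skip (.inr ⟨fun h => hc₁ h.1, _, _, _, _, _, _, h⟩))).mono (by omega) fun _ h => h
  · simp only [List.length_cons, List.length_nil]
    omega
  · simp only [List.length_cons, List.length_nil]
    omega

/-- The loop may stop before depth l; any stopping depth certifies its own accuracy, and l only
limits the number of rounds, each charged at the cost of the deepest one. -/
theorem estimate_loops {H : SimpleGraph ℕ} {n Δ : ℕ} {lam eps : ℝ} {t l : ℕ} {s : State}
    (hdeg : ∀ U v, (nbrs H U v).card ≤ Δ) (htl : t ≤ l)
    (hl : Close eps (estimate H lam l n) (estimate H lam (l + 1) n))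
    (h : Ready H n lam eps t 1 s) :
    Loops (.lt 1 8) estimateStep s
      (((6 * n + 103) * searchBound n Δ (l + 1) * n + 31) * (l + 1 - t)) fun s' =>
      ∃ t', Close eps (estimate H lam t' n) (estimate H lam (t' + 1) n) ∧
        Ready H n lam eps (t' + 1) 0 s' := by
  obtain ⟨j, rfl⟩ := Nat.exists_eq_add_of_le htl
  induction j generalizing t s with
  | zero =>
    refine (Loops.once ?_ (estimateStep_runs hdeg h)).mono ?_ fun s' h' => ?_
    · obtain ⟨m, prev, Z, u, vert, acc, h⟩ := h
      simp [Test.Holds, h.reg1, h.reg8]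
    · rw [add_zero, Nat.add_sub_cancel_left, mul_one]
      omega
    · exact ⟨t, h'.elim id fun h' => absurd hl h'.1⟩
  | succ j ih =>
    set c := (6 * n + 103) * searchBound n Δ (t + (j + 1) + 1) * n with hc
    refine ((Loops.once ?_ (estimateStep_runs hdeg h)).trans (b' := (c + 31) * (j + 1))
      fun s' h' => ?_).mono ?_ fun s' h' => h'
    · obtain ⟨m, prev, Z, u, vert, acc, h⟩ := h
      simp [Test.Holds, h.reg1, h.reg8]
    · rcases h' with h' | h'
      · exact .refl _ ⟨t, h'⟩
      · rw [show t + (j + 1) = t + 1 + j by ring] at hl hc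
        refine (ih h'.2 (by omega) hl).mono ?_ fun _ h => h
        rw [hc, show t + 1 + j + 1 - (t + 1) = j + 1 by omega]
    · have : (6 * n + 103) * searchBound n Δ (t + 1) * n ≤ c := by
        have := searchBound_mono n Δ (show t + 1 ≤ t + (j + 1) + 1 by omega)
        rw [hc]
        gcongr
      rw [show t + (j + 1) + 1 - t = j + 2 by omega]
      nlinarith

/-! ### Transfer from the input graph and correctness of the algorithm -/

theorem map_val_adj {n : ℕ} (G : SimpleGraph (Fin n)) {u v : ℕ} (hu : u < n) (hv : v < n) :
    (G.map Fin.valEmbedding).Adj v u ↔ G.Adj ⟨v, hv⟩ ⟨u, hu⟩ :=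
  SimpleGraph.map_adj_apply (f := Fin.valEmbedding) (a := ⟨v, hv⟩) (b := ⟨u, hu⟩)

theorem card_nbrs_map_val_le {n : ℕ} (G : SimpleGraph (Fin n)) [DecidableRel G.Adj] {Δ : ℕ}
    (hΔ : G.maxDegree ≤ Δ) (U : Finset ℕ) (v : ℕ) :
    (nbrs (G.map Fin.valEmbedding) U v).card ≤ Δ := by
  by_cases hv : v < n
  · refine le_trans ?_ ((G.degree_le_maxDegree ⟨v, hv⟩).trans hΔ)
    rw [← G.card_neighborFinset_eq_degree, ← Finset.card_map Fin.valEmbedding]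
    refine Finset.card_le_card fun u hu => ?_
    obtain ⟨a, b, h, rfl, rfl⟩ := (SimpleGraph.map_adj ..).1 (mem_nbrs.1 hu).2
    exact Finset.mem_map_of_mem _ (by simpa using h)
  · rw [Finset.card_eq_zero.2]
    · exact Nat.zero_le _
    · refine Finset.eq_empty_of_forall_notMem fun u hu => ?_
      obtain ⟨a, b, h, rfl, rfl⟩ := (SimpleGraph.map_adj ..).1 (mem_nbrs.1 hu).2
      exact hv a.2

theorem partitionFunctionOn_map_val {n : ℕ} (G : SimpleGraph (Fin n)) (lam : ℝ) :
    partitionFunctionOn (G.map Fin.valEmbedding) lam (Finset.range n) =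
      partitionFunction G lam := by
  rw [← partitionFunctionOn_univ, ← partitionFunctionOn_map G Fin.valEmbedding,
    Fin.map_valEmbedding_univ, Nat.Iio_eq_range]

/-- Depth 0 needs no computation, as all its factors are 1. Register 4 is 1 rather than 0 because
the root counts as a vertex of the path; the zero cells behind the matrix are the flags of an empty
path. -/
theorem ready_of_input {n : ℕ} (G : SimpleGraph (Fin n)) [DecidableRel G.Adj] {lam eps : ℝ}
    {s : State} (h1 : s.reg 1 = 0) (h0 : s.reg 0 = n) (h2 : s.reg 2 = 1) (h3 : s.reg 3 = n * n)
    (h4 : s.reg 4 = 1) (h5 : s.reg 5 = 0) (h6 : s.reg 6 = 0) (h8 : s.reg 8 = 1)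
    (r0 : s.rreg 0 = lam) (r1 : s.rreg 1 = eps) (r2 : s.rreg 2 = 1) (r4 : s.rreg 4 = 1)
    (hmem : s.mem = (input G lam eps).mem) :
    Ready (G.map Fin.valEmbedding) n lam eps 0 1 s := by
  refine ⟨0, s.rreg 3, s.rreg 5, s.reg 7, fun i => s.mem (n * n + 2 * i + 1), s.rmem,
    h0, h1, h2, h3, h4, h5, h6, rfl, h8, r0, r1, r2, rfl, ?_, rfl, ?_, ?_, fun _ _ => rfl,
    fun _ _ => rfl⟩
  · simp [r4, estimate, approx]
  · intro v hv u hu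
    have hv : v < n := hv
    have hu : u < n := hu
    have h1 : (u + v * n) / n = v := by
      rw [Nat.add_mul_div_right _ _ (by omega), Nat.div_eq_of_lt hu, zero_add]
    have h2 : (u + v * n) % n = u := by rw [Nat.add_mul_mod_self_right, Nat.mod_eq_of_lt hu]
    simp only [hmem, input, map_val_adj G hu hv]
    rw [dif_pos (add_mul_lt hu hv)]
    simp only [h1, h2]
  · intro i
    simp [hmem, input]

theorem algorithm_runs {n Δ : ℕ} (G : SimpleGraph (Fin n)) [DecidableRel G.Adj] {lam eps : ℝ}
    (hΔ : G.maxDegree ≤ Δ) (hlam : 0 < lam) (heps : 0 < eps) {l : ℕ}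
    (hl : Close eps (estimate (G.map Fin.valEmbedding) lam l n)
      (estimate (G.map Fin.valEmbedding) lam (l + 1) n)) :
    Runs algorithm (input G lam eps)
      (((6 * n + 103) * searchBound n Δ (l + 1) * n + 31) * (l + 1) + (6 * n + 40))
      fun s => IsApprox eps s.output (partitionFunction G lam) := by
  refine (Runs.seq (b := 13) (.block (Q := (· = _)) rfl) ?_).mono (b := 1 + (13 + (1 + (6 * n + 1 + (1 + (3 +
    (1 + ((((6 * n + 103) * searchBound n Δ (l + 1) * n + 31) * (l + 1) + 1) + 3))))))))
    (by omega) fun _ h => h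
  rintro s₁ rfl
  refine Runs.seq ((mulLoop_runs (by simp [Instr.exec, input]) (by simp [Instr.exec])).mono
    (by simp [Instr.exec, input]) fun _ h => h) ?_
  rintro s₂ rfl
  refine Runs.seq (.block (Q := Ready (G.map Fin.valEmbedding) n lam eps 0 1) ?_) fun s₃ h₃ =>
    Runs.seq ((estimate_loops (card_nbrs_map_val_le G hΔ) l.zero_le hl h₃).exit fun s₄ h₄ => ?_)
      fun s₄ h₄ => .block ?_
  · apply ready_of_input <;> simp [Instr.exec, State.setMul, input]
  · obtain ⟨t, -, m, prev, Z, u, vert, acc, h⟩ := h₄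
    simp [Test.Holds, h.reg1, h.reg8]
  · obtain ⟨t, ht, m, prev, Z, u, vert, acc, h⟩ := h₄
    have := isApprox_of_close _ hlam heps ht
    rw [partitionFunctionOn_map_val] at this
    simpa [State.output, Instr.exec, h.rreg4, h.rreg2] using this

/-! ### Running time -/

/-- The summand n + 1 on the left makes the induction close: the two copies of n + 1 that arise are
at most Δ (n + 1). -/
theorem searchBound_lt {n Δ : ℕ} (hΔ : 2 ≤ Δ) (t : ℕ) :
    searchBound n Δ t + (n + 1) ≤ (n + 1) * Δ ^ (t + 1) := by
  induction t with
  | zero =>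
    simp only [searchBound, zero_add, pow_one]
    nlinarith
  | succ t ih =>
    have := Nat.mul_le_mul_left Δ ih
    rw [searchBound, pow_succ]
    nlinarith

theorem time_le {n Δ l : ℕ} {eps M : ℝ} (hn : 2 ≤ n) (hΔ : 2 ≤ Δ) (heps : 0 < eps) (heps1 : eps < 1)
    (hM : 1 ≤ M) (hl : (l : ℝ) ≤ 20 * (M * Real.log (n / eps))) :
    ((((6 * n + 103) * searchBound n Δ (l + 1) * n + 31) * (l + 1) + (6 * n + 40) : ℕ) : ℝ) ≤
      (n / eps) ^ (70 * M * Real.log Δ) := by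
  have hn' : (2 : ℝ) ≤ n := by exact_mod_cast hn
  have hΔ' : (2 : ℝ) ≤ Δ := by exact_mod_cast hΔ
  have hnX : (n : ℝ) ≤ n / eps := by
    rw [le_div_iff₀ heps]
    nlinarith
  set X : ℝ := n / eps with hX
  have hX2 : 2 ≤ X := hn'.trans hnX
  have hlog : ∀ y : ℝ, 2 ≤ y → 1 / 2 ≤ Real.log y := fun y hy => by
    have := Real.log_two_gt_d9
    have := Real.log_le_log (by norm_num) hy
    linarith
  have hLX := hlog X hX2
  have hLΔ := hlog Δ hΔ'
  set P : ℝ := (Δ : ℝ) ^ (l + 2) with hP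
  have hP1 : 1 ≤ P := one_le_pow₀ (by linarith)
  have hS : (searchBound n Δ (l + 1) : ℝ) ≤ 2 * X * P := by
    have h := searchBound_lt (n := n) hΔ (l + 1)
    have h : (searchBound n Δ (l + 1) : ℝ) + (n + 1) ≤ (n + 1) * P := by
      rw [hP]
      exact_mod_cast h
    have : (n + 1 : ℝ) * P ≤ 2 * X * P := by
      gcongr
      linarith
    linarith
  have hlP : (l + 1 : ℝ) ≤ P := by
    have h : l + 1 ≤ Δ ^ (l + 2) := calc
      l + 1 ≤ 2 ^ (l + 1) := Nat.lt_two_pow_self.le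
      _ ≤ Δ ^ (l + 1) := Nat.pow_le_pow_left hΔ _
      _ ≤ Δ ^ (l + 2) := Nat.pow_le_pow_right (by omega) (by omega)
    rw [hP]
    exact_mod_cast h
  have hX3 : 1 ≤ X ^ 3 := one_le_pow₀ (by linarith)
  -- The constants add up to 173 ≤ 2 ^ 8 ≤ X ^ 8, so they become a power of X.
  have h1 : ((((6 * n + 103) * searchBound n Δ (l + 1) * n + 31) * (l + 1) + (6 * n + 40) : ℕ) : ℝ) ≤
      X ^ 11 * P ^ 2 := by
    push_cast
    have hX8 : (2 : ℝ) ^ 8 ≤ X ^ 8 := by gcongr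
    have hXX : X ≤ X ^ 3 := le_self_pow₀ (by linarith) (by norm_num)
    have hPP : P ≤ P ^ 2 := le_self_pow₀ hP1 (by norm_num)
    calc ((6 * n + 103) * searchBound n Δ (l + 1) * n + 31) * (l + 1) + (6 * n + 40 : ℝ)
        ≤ ((58 * X) * (2 * X * P) * X + 31) * P + 26 * X := by
          gcongr
          · linarith
          · linarith
      _ = 116 * (X ^ 3 * P ^ 2) + 31 * (1 * P) + 26 * (X * 1) := by ring
      _ ≤ 116 * (X ^ 3 * P ^ 2) + 31 * (X ^ 3 * P ^ 2) + 26 * (X ^ 3 * P ^ 2) := by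
          gcongr
          nlinarith
      _ = 173 * (X ^ 3 * P ^ 2) := by ring
      _ ≤ X ^ 8 * (X ^ 3 * P ^ 2) := by
          gcongr
          linarith
      _ = _ := by ring
  have hX0 : 0 < X := by linarith
  refine h1.trans ?_
  rw [← Real.log_le_log_iff (by positivity) (by positivity), Real.log_rpow hX0,
    Real.log_mul (by positivity) (by positivity), Real.log_pow, Real.log_pow, hP, Real.log_pow]
  push_cast
  set a := Real.log X
  set b := Real.log Δ
  -- The logarithm to be bounded is 11 a + 2 (l + 2) b. Here 11 a ≤ 22 M a b, 2 l b ≤ 40 M a b and 4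
  -- b ≤ 8 M a b, which gives the constant 70.
  have hMa : 1 / 2 ≤ M * a := by nlinarith
  have h2 : l * b ≤ 20 * (M * a) * b := by gcongr
  have h3 : b / 2 ≤ M * a * b := by nlinarith
  have h4 : a / 2 ≤ M * a * b := by
    have : 1 / 2 ≤ M * b := by nlinarith
    nlinarith
  nlinarith

end RealRAM
end

theorem mainTheorem10 :
    ∃ (P : RealRAM.Prog) (C : ℝ), 0 < C ∧
      ∀ (n Δ : ℕ) (G : SimpleGraph (Fin n)) [DecidableRel G.Adj] (lam eps : ℝ),
        G.maxDegree ≤ Δ → 0 < lam → 0 < eps → eps < 1 →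
        ∃ (T : ℕ) (s : RealRAM.State),
          RealRAM.HaltsWithin P (RealRAM.input G lam eps) T s ∧
          MonomerDimer.IsApprox eps s.output (MonomerDimer.partitionFunction G lam) ∧
          (2 ≤ n → 2 ≤ Δ →
            (T : ℝ) ≤ ((n : ℝ) / eps) ^
              (C * max 1 (Real.sqrt (lam * (Δ : ℝ))) * Real.log (Δ : ℝ))) := by
  refine ⟨RealRAM.algorithm, 70, by norm_num, fun n Δ G _ lam eps hΔ hlam heps heps1 => ?_⟩
  by_cases h : 2 ≤ n ∧ 2 ≤ Δ
  · obtain ⟨l, hl, hc⟩ := MonomerDimer.exists_close_estimate (G.map Fin.valEmbedding) hlam heps heps1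
      h.1 h.2 (RealRAM.card_nbrs_map_val_le G hΔ)
    obtain ⟨T, hT, s, hs, ha⟩ := RealRAM.HaltsWithin.of_runs
      (RealRAM.algorithm_runs G hΔ hlam heps hc)
    exact ⟨T, s, hs, ha, fun _ _ => (Nat.cast_le.2 hT).trans
      (RealRAM.time_le h.1 h.2 heps heps1 (le_max_left _ _) hl)⟩
  -- Only halting and correctness are claimed here; exactness at depth n gives both without any
  -- contraction.
  · obtain ⟨T, -, s, hs, ha⟩ := RealRAM.HaltsWithin.of_runs (RealRAM.algorithm_runs G hΔ hlam heps
      (MonomerDimer.close_estimate_self (G.map Fin.valEmbedding) hlam heps (le_refl n)))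
    exact ⟨T, s, hs, ha, fun h1 h2 => absurd ⟨h1, h2⟩ h⟩
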